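/- Let $\mathcal A$ be a unital $C^*$-algebra with a state $\varphi$, let $I$ be an index set with at least two elements, and for each $i\in I$ let $A_l^{(i)},A_r^{(i)}\subseteq\mathcal A$ be unital $C^*$-subalgebras (containing the unit of $\mathcal A$), called the left and right face of the $i$-th pair. Let $C_i=C^*(A_l^{(i)},A_r^{(i)})\subseteq\mathcal A$ be the $C^*$-algebra they generate and let $\varphi_i=\varphi|_{C_i}$. Assume that $C_i\neq\mathbb C 1$ and that $\varphi_i$ is faithful on $C_i$ for every $i\in I$ (a state $\psi$ is faithful if $\psi(x^*x)=0$ implies $x=0$). Let $(\pi_i,H_i,\xi_i)$ be the GNS construction of $(C_i,\varphi_i)$, let $\mathring H_i=H_i\ominus\mathbb C\xi_i$, and let $$H=\mathbb C\xi\oplus\bigoplus_{n\ge 1,\ i_1\ne i_2\ne\cdots\ne i_n}\mathring H_{i_1}\otimes\cdots\otimes\mathring H_{i_n}$$ be the free product Hilbert space with unit vector $\xi$, where $i_1\neq i_2\neq\cdots\neq i_n$ means that consecutive indices are distinct. Let $H(l,i)$ (respectively $H(r,i)$) be the closed subspace of $H$ given by $\mathbb C\xi$ and the summands with $i_1\ne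 i$ (respectively $i_n\neq i$). Let $V_i:H_i\otimes H(l,i)\to H$ and $W_i:H(r,i)\otimes H_i\to H$ be the unitaries given by concatenation of tensors, with $\xi_i$ and $\xi$ absorbed, and for $T\in B(H_i)$ put $\lambda_i(T)=V_i(T\otimes 1)V_i^*$ and $\rho_i(T)=W_i(1\otimes T)W_i^*$. The reduced bi-free product is the $C^*$-subalgebra of $B(H)$ generated by $\lambda_i(\pi_i(A_l^{(i)}))$ and $\rho_i(\pi_i(A_r^{(i)}))$, $i\in I$, and the bi-free product state on it is $T\mapsto\langle T\xi,\xi\rangle$. If the bi-free product state is faithful on the reduced bi-free product, then for every $i\in I$ the faces $A_l^{(i)}$ and $A_r^{(i)}$ commute, and there is a $*$-isomorphism $$C^*(A_l^{(i)},A_r^{(i)})\;\cong\;A_l^{(i)}\otimes_{\min}A_r^{(i)}$$ sending $ab$ to $a\otimes b$ for all $a\in A_l^{(i)}$, $b\in A_r^{(i)}$. -/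

import Mathlib

open scoped TensorProduct InnerProductSpace ENNReal ComplexOrder

noncomputable section

namespace BiFree

universe u v

/-! ### Hilbert space tensor products -/

section HilbertTensor

variable {E F E' F' G : Type*}
  [NormedAddCommGroup E] [InnerProductSpace ℂ E] [NormedAddCommGroup F] [InnerProductSpace ℂ F]
  [NormedAddCommGroup E'] [InnerProductSpace ℂ E'] [NormedAddCommGroup F'] [InnerProductSpace ℂ F']
  [NormedAddCommGroup G] [InnerProductSpace ℂ G]

/-- The Hilbert space tensor product: the completion of the algebraic tensor product for
`⟪a ⊗ b, c ⊗ d⟫ = ⟪a, c⟫ * ⟪b, d⟫`. -/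
def HilbertTensor (E F : Type*) [NormedAddCommGroup E] [InnerProductSpace ℂ E]
    [NormedAddCommGroup F] [InnerProductSpace ℂ F] : Type _ :=
  UniformSpace.Completion (E ⊗[ℂ] F)

instance : NormedAddCommGroup (HilbertTensor E F) :=
  inferInstanceAs (NormedAddCommGroup (UniformSpace.Completion (E ⊗[ℂ] F)))

instance : InnerProductSpace ℂ (HilbertTensor E F) :=
  inferInstanceAs (InnerProductSpace ℂ (UniformSpace.Completion (E ⊗[ℂ] F)))

instance : CompleteSpace (HilbertTensor E F) :=
  inferInstanceAs (CompleteSpace (UniformSpace.Completion (E ⊗[ℂ] F)))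

/-- The inclusion of the algebraic tensor product in its completion. -/
def toHilbertTensor : (E ⊗[ℂ] F) →ₗᵢ[ℂ] HilbertTensor E F :=
  (UniformSpace.Completion.toComplₗᵢ : (E ⊗[ℂ] F) →ₗᵢ[ℂ] UniformSpace.Completion (E ⊗[ℂ] F))

theorem denseRange_toHilbertTensor :
    DenseRange (toHilbertTensor : (E ⊗[ℂ] F) →ₗᵢ[ℂ] HilbertTensor E F) :=
  UniformSpace.Completion.denseRange_coe (α := E ⊗[ℂ] F)

/-- The elementary tensor `x ⊗ y` in the Hilbert space tensor product, bilinear in `x` and `y`. -/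
def htmul : E →ₗ[ℂ] F →ₗ[ℂ] HilbertTensor E F :=
  (TensorProduct.mk ℂ E F).compr₂ toHilbertTensor.toLinearMap

theorem htmul_eq (x : E) (y : F) : htmul x y = toHilbertTensor (x ⊗ₜ[ℂ] y) := rfl

theorem inner_htmul (x x' : E) (y y' : F) :
    ⟪htmul x y, htmul x' y'⟫_ℂ = ⟪x, x'⟫_ℂ * ⟪y, y'⟫_ℂ := by
  rw [htmul_eq, htmul_eq, LinearIsometry.inner_map_map, TensorProduct.inner_tmul]

theorem norm_htmul (x : E) (y : F) : ‖htmul x y‖ = ‖x‖ * ‖y‖ := by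
  rw [htmul_eq, LinearIsometry.norm_map, TensorProduct.norm_tmul]

/-- The bounded operator `S ⊗ T`. -/
def hmap (S : E →L[ℂ] E') (T : F →L[ℂ] F') : HilbertTensor E F →L[ℂ] HilbertTensor E' F' :=
  ((TensorProduct.mapL S T).completion :
    UniformSpace.Completion (E ⊗[ℂ] F) →L[ℂ] UniformSpace.Completion (E' ⊗[ℂ] F'))

theorem hmap_toHilbertTensor (S : E →L[ℂ] E') (T : F →L[ℂ] F') (x : E ⊗[ℂ] F) :
    hmap S T (toHilbertTensor x) = toHilbertTensor (TensorProduct.mapL S T x) :=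
  ContinuousLinearMap.completion_apply_coe _ _

theorem hmap_htmul (S : E →L[ℂ] E') (T : F →L[ℂ] F') (x : E) (y : F) :
    hmap S T (htmul x y) = htmul (S x) (T y) :=
  hmap_toHilbertTensor S T _

theorem norm_hmap_le (S : E →L[ℂ] E') (T : F →L[ℂ] F') : ‖hmap S T‖ ≤ ‖S‖ * ‖T‖ := by
  refine ContinuousLinearMap.opNorm_le_bound _ (by positivity) fun x => ?_
  refine denseRange_toHilbertTensor.induction_on x
    (isClosed_le (by fun_prop) (by fun_prop)) fun a => ?_
  rw [hmap_toHilbertTensor, LinearIsometry.norm_map, LinearIsometry.norm_map]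
  exact (ContinuousLinearMap.le_opNorm _ _).trans
    (mul_le_mul_of_nonneg_right (TensorProduct.norm_mapL_le S T) (norm_nonneg _))

theorem inner_lift_lift (B : E →ₗ[ℂ] F →ₗ[ℂ] G)
    (hB : ∀ x x' y y', ⟪B x y, B x' y'⟫_ℂ = ⟪x, x'⟫_ℂ * ⟪y, y'⟫_ℂ) (x y : E ⊗[ℂ] F) :
    ⟪TensorProduct.lift B x, TensorProduct.lift B y⟫_ℂ = ⟪x, y⟫_ℂ := by
  induction x using TensorProduct.induction_on with
  | zero => simp
  | add x₁ x₂ h₁ h₂ => simp only [map_add, inner_add_left, h₁, h₂]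
  | tmul a b =>
    induction y using TensorProduct.induction_on with
    | zero => simp
    | add y₁ y₂ h₁ h₂ => simp only [map_add, inner_add_right, h₁, h₂]
    | tmul c d => simp [hB]

/-- `x ⊗ y` as a bounded linear map in `y`. -/
def htmulL : E →ₗ[ℂ] F →L[ℂ] HilbertTensor E F where
  toFun x := (htmul x).mkContinuous ‖x‖ fun y => (norm_htmul x y).le
  map_add' x x' := by ext; simp
  map_smul' c x := by ext; simp

/-- `1 ⊗ T`, linear in `T`. -/
def hmapRight : (F →L[ℂ] F') →ₗ[ℂ] HilbertTensor E F →L[ℂ] HilbertTensor E F' where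
  toFun T := hmap (.id ℂ E) T
  map_add' S T := ContinuousLinearMap.ext fun x =>
    denseRange_toHilbertTensor.induction_on x
      (isClosed_eq (ContinuousLinearMap.continuous _) (ContinuousLinearMap.continuous _))
      fun a => by
        simp [hmap_toHilbertTensor, TensorProduct.mapL_add_right, -TensorProduct.mapL_apply]
  map_smul' c T := ContinuousLinearMap.ext fun x =>
    denseRange_toHilbertTensor.induction_on x
      (isClosed_eq (ContinuousLinearMap.continuous _) (ContinuousLinearMap.continuous _))
      fun a => by
        simp [hmap_toHilbertTensor, TensorProduct.mapL_smul_right, -TensorProduct.mapL_apply]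

theorem inner_hmap_id {S T : F →L[ℂ] F'} {c : ℂ} (h : ∀ y y', ⟪S y, T y'⟫_ℂ = c * ⟪y, y'⟫_ℂ)
    (x x' : HilbertTensor E F) :
    ⟪hmap (.id ℂ E) S x, hmap (.id ℂ E) T x'⟫_ℂ = c * ⟪x, x'⟫_ℂ := by
  refine denseRange_toHilbertTensor.induction_on₂ (isClosed_eq (by fun_prop) (by fun_prop))
    (fun a b => ?_) x x'
  rw [hmap_toHilbertTensor, hmap_toHilbertTensor, LinearIsometry.inner_map_map,
    LinearIsometry.inner_map_map]
  induction a using TensorProduct.induction_on with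
  | zero => simp
  | add a₁ a₂ h₁ h₂ => simp only [map_add, inner_add_left, h₁, h₂, mul_add]
  | tmul a y =>
    induction b using TensorProduct.induction_on with
    | zero => simp
    | add b₁ b₂ h₁ h₂ => simp only [map_add, inner_add_right, h₁, h₂, mul_add]
    | tmul b z =>
      simp only [TensorProduct.mapL_tmul, TensorProduct.inner_tmul, h,
        ContinuousLinearMap.id_apply]
      ring

/-- The continuous extension of a linear map from the algebraic tensor product. -/
def hextend [CompleteSpace G] (f : (E ⊗[ℂ] F) →L[ℂ] G) : HilbertTensor E F →L[ℂ] G :=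
  (f.fromCompletion : UniformSpace.Completion (E ⊗[ℂ] F) →L[ℂ] G)

theorem hextend_toHilbertTensor [CompleteSpace G] (f : (E ⊗[ℂ] F) →L[ℂ] G) (x : E ⊗[ℂ] F) :
    hextend f (toHilbertTensor x) = f x :=
  ContinuousLinearMap.fromCompletion_apply_coe _ _

/-- A bilinear map which multiplies inner products as the tensor product does extends to a
linear isometry of the Hilbert space tensor product. -/
def hlift [CompleteSpace G] (B : E →ₗ[ℂ] F →ₗ[ℂ] G)
    (hB : ∀ x x' y y', ⟪B x y, B x' y'⟫_ℂ = ⟪x, x'⟫_ℂ * ⟪y, y'⟫_ℂ) :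
    HilbertTensor E F →ₗᵢ[ℂ] G where
  toLinearMap := (hextend ((TensorProduct.lift B).isometryOfInner
    (inner_lift_lift B hB)).toContinuousLinearMap).toLinearMap
  norm_map' x := by
    refine denseRange_toHilbertTensor.induction_on x
      (isClosed_eq (ContinuousLinearMap.continuous _).norm continuous_norm) fun a => ?_
    rw [LinearIsometry.norm_map]
    exact (congrArg norm (hextend_toHilbertTensor _ a)).trans (LinearIsometry.norm_map _ a)

theorem hlift_htmul [CompleteSpace G] (B : E →ₗ[ℂ] F →ₗ[ℂ] G)
    (hB : ∀ x x' y y', ⟪B x y, B x' y'⟫_ℂ = ⟪x, x'⟫_ℂ * ⟪y, y'⟫_ℂ) (x : E) (y : F) :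
    hlift B hB (htmul x y) = B x y :=
  (hextend_toHilbertTensor _ _).trans (TensorProduct.lift.tmul x y)

end HilbertTensor

/-! ### States and the GNS construction -/

/-- A state: a linear functional with `φ 1 = 1` and `0 ≤ φ (a* a)` for all `a`. -/
structure State (A : Type*) [Ring A] [StarRing A] [Algebra ℂ A] extends A →ₗ[ℂ] ℂ where
  map_one' : toFun 1 = 1
  nonneg' : ∀ a, 0 ≤ toFun (star a * a)

namespace State

instance {A : Type*} [Ring A] [StarRing A] [Algebra ℂ A] : CoeFun (State A) (fun _ => A → ℂ) :=
  ⟨fun φ => φ.toLinearMap⟩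

/-- `φ` is faithful if `φ (a* a) = 0` only for `a = 0`. -/
def IsFaithful {A : Type*} [Ring A] [StarRing A] [Algebra ℂ A] (φ : State A) : Prop :=
  ∀ a, φ (star a * a) = 0 → a = 0

/-- The restriction of a state to a unital *-subalgebra. -/
def restrict {A : Type*} [Ring A] [StarRing A] [Algebra ℂ A] [StarModule ℂ A]
    (φ : State A) (S : StarSubalgebra ℂ A) : State S where
  toLinearMap := φ.toLinearMap ∘ₗ S.toSubalgebra.val.toLinearMap
  map_one' := φ.map_one'
  nonneg' a := φ.nonneg' (a : A)

end State

/-- A Hilbert space with a distinguished unit vector. -/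
structure PointedHilbert where
  carrier : Type u
  [normedAddCommGroup : NormedAddCommGroup carrier]
  [innerProductSpace : InnerProductSpace ℂ carrier]
  [completeSpace : CompleteSpace carrier]
  vacuum : carrier
  norm_vacuum : ‖vacuum‖ = 1

attribute [instance] PointedHilbert.normedAddCommGroup PointedHilbert.innerProductSpace
  PointedHilbert.completeSpace

section GNS

variable {A : Type u} [CStarAlgebra A] (φ : State A)

/-- A state as a positive linear map for the usual order of a C*-algebra (`0 ≤ a` iff `a` is
selfadjoint with nonnegative spectrum). -/
def State.toPositive : letI := CStarAlgebra.spectralOrder A; A →ₚ[ℂ] ℂ :=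
  letI := CStarAlgebra.spectralOrder A
  letI := CStarAlgebra.spectralOrderedRing A
  PositiveLinearMap.mk₀ φ.toLinearMap fun a ha => by
    obtain ⟨b, rfl⟩ := CStarAlgebra.nonneg_iff_eq_star_mul_self.mp ha
    exact φ.nonneg' b

/-- The GNS Hilbert space with its canonical cyclic vector, the class of `1`. -/
def State.gns : PointedHilbert.{u} :=
  letI := CStarAlgebra.spectralOrder A
  letI := CStarAlgebra.spectralOrderedRing A
  { carrier := φ.toPositive.GNS
    vacuum := ((φ.toPositive.toPreGNS 1 : φ.toPositive.PreGNS) : φ.toPositive.GNS)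
    norm_vacuum := by
      have h : φ.toPositive 1 = 1 := φ.map_one'
      rw [UniformSpace.Completion.norm_coe, PositiveLinearMap.preGNS_norm_def]
      simp [h] }

/-- The GNS representation `a ↦ (b ↦ a b)`. -/
def State.rep : A →⋆ₐ[ℂ] (φ.gns.carrier →L[ℂ] φ.gns.carrier) :=
  letI := CStarAlgebra.spectralOrder A
  letI := CStarAlgebra.spectralOrderedRing A
  φ.toPositive.gnsStarAlgHom

end GNS

/-! ### The minimal tensor product -/

section MinTensor

variable (A B : Type u) [CStarAlgebra A] [CStarAlgebra B]

/-- The bounded operators on the tensor product of the GNS spaces of two states. -/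
abbrev GNSTensorOp (p : State A × State B) : Type u :=
  HilbertTensor p.1.gns.carrier p.2.gns.carrier →L[ℂ]
    HilbertTensor p.1.gns.carrier p.2.gns.carrier

instance (p : State A × State B) :
    Nontrivial (HilbertTensor p.1.gns.carrier p.2.gns.carrier) :=
  ⟨⟨htmul p.1.gns.vacuum p.2.gns.vacuum, 0, fun h => by
    have := norm_htmul p.1.gns.vacuum p.2.gns.vacuum
    rw [h, p.1.gns.norm_vacuum, p.2.gns.norm_vacuum] at this
    simp at this⟩⟩

instance (p : State A × State B) : NormOneClass (GNSTensorOp A B p) := inferInstance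

variable {A B} in
/-- The family of operators `π_φ a ⊗ π_ψ b`, over all pairs of states `φ` of `A` and `ψ` of `B`. -/
def tensorFamily (a : A) (b : B) : lp (GNSTensorOp A B) ∞ :=
  ⟨fun p => hmap (p.1.rep a) (p.2.rep b), memℓp_infty ⟨‖a‖ * ‖b‖, by
    rintro _ ⟨p, rfl⟩
    exact (norm_hmap_le _ _).trans (mul_le_mul (NonUnitalStarAlgHom.norm_apply_le _ _)
      (NonUnitalStarAlgHom.norm_apply_le _ _) (norm_nonneg _) (norm_nonneg _))⟩⟩

/-- The minimal (spatial) tensor product of two unital C*-algebras: the C*-algebra generated by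
the elementary tensors `a ⊗ b` in the representation `⊕ π_φ ⊗ π_ψ` over all pairs of states, so
that `‖x‖ = sup ‖(π_φ ⊗ π_ψ) x‖` for `x` in the algebraic tensor product. -/
def MinTensor : StarSubalgebra ℂ (lp (GNSTensorOp A B) ∞) :=
  (StarAlgebra.adjoin ℂ {x | ∃ a b, x = tensorFamily (A := A) (B := B) a b}).topologicalClosure

variable {A B} in
/-- The elementary tensor `a ⊗ b` in the minimal tensor product. -/
def MinTensor.tmul (a : A) (b : B) : MinTensor A B :=
  ⟨tensorFamily a b, StarSubalgebra.le_topologicalClosure _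
    (StarAlgebra.subset_adjoin ℂ _ ⟨a, b, rfl⟩)⟩

end MinTensor

/-! ### The free product of Hilbert spaces -/

section FreeProduct

/-- The orthogonal complement of the distinguished vector. -/
abbrev PointedHilbert.reduced (P : PointedHilbert.{u}) : Submodule ℂ P.carrier :=
  (ℂ ∙ P.vacuum)ᗮ

/-- The component of a vector orthogonal to the distinguished vector. -/
def PointedHilbert.proj (P : PointedHilbert.{u}) : P.carrier →L[ℂ] P.reduced :=
  P.reduced.orthogonalProjectionOnto

theorem PointedHilbert.inner_eq (P : PointedHilbert.{u}) (x y : P.carrier) :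
    ⟪x, y⟫_ℂ = ⟪x, P.vacuum⟫_ℂ * ⟪P.vacuum, y⟫_ℂ + ⟪P.proj x, P.proj y⟫_ℂ := by
  have hx : ∀ z : P.carrier, z = ⟪P.vacuum, z⟫_ℂ • P.vacuum + (P.proj z : P.carrier) := by
    intro z
    have h := (ℂ ∙ P.vacuum).starProjection_add_starProjection_orthogonal z
    rw [Submodule.starProjection_unit_singleton ℂ P.norm_vacuum] at h
    exact h.symm
  have h0 : ∀ z : P.reduced, ⟪P.vacuum, (z : P.carrier)⟫_ℂ = 0 := fun z =>
    Submodule.mem_orthogonal_singleton_iff_inner_right.mp z.2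
  have h0' : ∀ z : P.reduced, ⟪(z : P.carrier), P.vacuum⟫_ℂ = 0 := fun z =>
    Submodule.mem_orthogonal_singleton_iff_inner_left.mp z.2
  have h1 : ⟪P.vacuum, P.vacuum⟫_ℂ = 1 := by
    rw [inner_self_eq_norm_sq_to_K, P.norm_vacuum]; simp
  conv_lhs => rw [hx x, hx y]
  simp only [inner_add_left, inner_add_right, inner_smul_left, inner_smul_right, h0, h0', h1,
    inner_conj_symm, Submodule.coe_inner]
  ring

section Concat

variable {α β : Type*} {K : β → Type*} [∀ b, NormedAddCommGroup (K b)]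

open Classical in
/-- Transport of a family along an injection, extended by zero. -/
def push (e : α ↪ β) (x : ∀ a, K (e a)) (b : β) : K b :=
  if h : ∃ a, e a = b then h.choose_spec ▸ x h.choose else 0

theorem push_apply (e : α ↪ β) (x : ∀ a, K (e a)) (a : α) : push e x (e a) = x a := by
  have h : ∃ a', e a' = e a := ⟨a, rfl⟩
  rw [push, dif_pos h]
  have key : ∀ (a' : α) (h' : e a' = e a), (h' ▸ x a' : K (e a)) = x a := by
    intro a' h'
    obtain rfl := e.injective h'
    rfl
  exact key _ _

theorem push_of_notMem (e : α ↪ β) (x : ∀ a, K (e a)) {b : β} (hb : b ∉ Set.range e) :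
    push e x b = 0 :=
  dif_neg hb

theorem memℓp_push (e : α ↪ β) {x : ∀ a, K (e a)} (hx : Memℓp x 2) : Memℓp (push (K := K) e x) 2 := by
  rw [memℓp_gen_iff (by norm_num)] at hx ⊢
  rw [← e.injective.summable_iff (fun b hb => by simp [push_of_notMem e x hb])]
  simpa [Function.comp_def, push_apply] using hx

variable [∀ b, InnerProductSpace ℂ (K b)]

/-- The isometric inclusion of the partial Hilbert sum over the range of `e`. -/
def pushLp (e : α ↪ β) : lp (fun a => K (e a)) 2 →ₗ[ℂ] lp K 2 where
  toFun x := ⟨push e x, memℓp_push e (lp.memℓp x)⟩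
  map_add' x y := lp.ext (funext fun b => by
    change push e (x + y) b = push e x b + push e y b
    by_cases hb : b ∈ Set.range e
    · obtain ⟨a, rfl⟩ := hb
      rw [push_apply, push_apply, push_apply]
      rfl
    · rw [push_of_notMem e _ hb, push_of_notMem e _ hb, push_of_notMem e _ hb, add_zero])
  map_smul' c x := lp.ext (funext fun b => by
    change push e (c • x) b = c • push e x b
    by_cases hb : b ∈ Set.range e
    · obtain ⟨a, rfl⟩ := hb
      rw [push_apply, push_apply]
      rfl
    · rw [push_of_notMem e _ hb, push_of_notMem e _ hb, smul_zero])

theorem pushLp_apply (e : α ↪ β) (x : lp (fun a => K (e a)) 2) (b : β) :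
    pushLp e x b = push e x b := rfl

theorem inner_pushLp (e : α ↪ β) (x y : lp (fun a => K (e a)) 2) :
    ⟪(pushLp e x : lp K 2), pushLp e y⟫_ℂ = ⟪x, y⟫_ℂ := by
  rw [lp.inner_eq_tsum, lp.inner_eq_tsum, ← e.injective.tsum_eq]
  · simp [pushLp_apply, push_apply]
  · intro b hb
    by_contra h
    exact hb (by simp [pushLp_apply, push_of_notMem e _ h])

theorem inner_pushLp_of_disjoint (e e' : α ↪ β) (h : ∀ a a', e a ≠ e' a')
    (x : lp (fun a => K (e a)) 2) (y : lp (fun a => K (e' a)) 2) :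
    ⟪(pushLp e x : lp K 2), pushLp e' y⟫_ℂ = 0 := by
  rw [lp.inner_eq_tsum]
  refine (tsum_congr fun b => ?_).trans tsum_zero
  by_cases hb : b ∈ Set.range e
  · obtain ⟨a, rfl⟩ := hb
    have : e a ∉ Set.range e' := by rintro ⟨a', ha'⟩; exact h a a' ha'.symm
    simp [pushLp_apply, push_of_notMem e' _ this]
  · simp [pushLp_apply, push_of_notMem e _ hb]

variable {E : Type*} [NormedAddCommGroup E] [InnerProductSpace ℂ E]

section mapLp

variable {G G' : α → Type*} [∀ a, NormedAddCommGroup (G a)] [∀ a, InnerProductSpace ℂ (G a)]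
  [∀ a, NormedAddCommGroup (G' a)] [∀ a, InnerProductSpace ℂ (G' a)]
  (c : ∀ a, E →ₗ[ℂ] G a →ₗ[ℂ] G' a)

theorem memℓp_map
    (hc : ∀ a x x' y y', ⟪c a x y, c a x' y'⟫_ℂ = ⟪x, x'⟫_ℂ * ⟪y, y'⟫_ℂ)
    (h : E) (x : lp G 2) : Memℓp (fun a => c a h (x a)) 2 := by
  have hn : ∀ a, ‖c a h (x a)‖ = ‖h‖ * ‖x a‖ := fun a => by
    have := hc a h h (x a) (x a)
    rw [inner_self_eq_norm_sq_to_K, inner_self_eq_norm_sq_to_K,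
      inner_self_eq_norm_sq_to_K, ← mul_pow] at this
    norm_cast at this
    exact (pow_left_inj₀ (norm_nonneg _) (by positivity) two_ne_zero).mp this
  have hx := (lp.memℓp x).summable (by norm_num)
  rw [memℓp_gen_iff (by norm_num)]
  refine (hx.mul_left (‖h‖ ^ (2 : ℝ≥0∞).toReal)).congr fun a => ?_
  rw [hn, Real.mul_rpow (norm_nonneg _) (norm_nonneg _)]

/-- Componentwise application of bilinear maps in a Hilbert sum. -/
def mapLp (hc : ∀ a x x' y y', ⟪c a x y, c a x' y'⟫_ℂ = ⟪x, x'⟫_ℂ * ⟪y, y'⟫_ℂ) :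
    E →ₗ[ℂ] lp G 2 →ₗ[ℂ] lp G' 2 :=
  LinearMap.mk₂ ℂ (fun h x => ⟨fun a => c a h (x a), memℓp_map c hc h x⟩)
    (fun h h' x => lp.ext (funext fun a => (c a).map_add₂ h h' (x a)))
    (fun r h x => lp.ext (funext fun a => (c a).map_smul₂ r h (x a)))
    (fun h x y => lp.ext (funext fun a => (c a h).map_add (x a) (y a)))
    (fun r h x => lp.ext (funext fun a => (c a h).map_smul r (x a)))

theorem inner_mapLp
    (hc : ∀ a x x' y y', ⟪c a x y, c a x' y'⟫_ℂ = ⟪x, x'⟫_ℂ * ⟪y, y'⟫_ℂ)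
    (h h' : E) (x y : lp G 2) :
    ⟪mapLp c hc h x, mapLp c hc h' y⟫_ℂ = ⟪h, h'⟫_ℂ * ⟪x, y⟫_ℂ := by
  rw [lp.inner_eq_tsum, lp.inner_eq_tsum, ← tsum_mul_left]
  exact tsum_congr fun a => hc a h h' (x a) (y a)

end mapLp

variable (Q : PointedHilbert.{u}) (e₀ e₁ : α ↪ β)
  (c : ∀ a, Q.reduced →ₗ[ℂ] K (e₀ a) →ₗ[ℂ] K (e₁ a))
  (hc : ∀ a x x' y y', ⟪c a x y, c a x' y'⟫_ℂ = ⟪x, x'⟫_ℂ * ⟪y, y'⟫_ℂ)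

/-- The concatenation map: if `h = z • ξ + h°` with `h°` orthogonal to the distinguished vector
`ξ`, then `(h, x)` is sent to `z • x`, which lives on the range of `e₀`, plus the family of the
`c a h° (x a)`, which lives on the range of `e₁`. -/
def concat : Q.carrier →ₗ[ℂ] lp (fun a => K (e₀ a)) 2 →ₗ[ℂ] lp K 2 :=
  LinearMap.mk₂ ℂ
    (fun h x => ⟪Q.vacuum, h⟫_ℂ • pushLp e₀ x + pushLp e₁ (mapLp c hc (Q.proj h) x))
    (fun h h' x => by
      simp only [inner_add_right, map_add, add_smul, LinearMap.add_apply]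
      abel)
    (fun r h x => by
      simp only [inner_smul_right, map_smul, smul_add, LinearMap.smul_apply, mul_smul])
    (fun h x y => by
      simp only [map_add, smul_add]
      abel)
    (fun r h x => by
      simp only [map_smul, smul_add]
      rw [smul_comm])

theorem concat_apply (h : Q.carrier) (x : lp (fun a => K (e₀ a)) 2) :
    concat Q e₀ e₁ c hc h x =
      ⟪Q.vacuum, h⟫_ℂ • pushLp e₀ x + pushLp e₁ (mapLp c hc (Q.proj h) x) := rfl

theorem inner_concat (hdisj : ∀ a a', e₀ a ≠ e₁ a') (h h' : Q.carrier) (x y : lp (fun a => K (e₀ a)) 2) :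
    ⟪concat Q e₀ e₁ c hc h x, concat Q e₀ e₁ c hc h' y⟫_ℂ = ⟪h, h'⟫_ℂ * ⟪x, y⟫_ℂ := by
  simp only [concat_apply, inner_add_left, inner_add_right, inner_smul_left, inner_smul_right,
    inner_pushLp, inner_mapLp, inner_pushLp_of_disjoint e₀ e₁ hdisj,
    inner_pushLp_of_disjoint e₁ e₀ (fun a a' => (hdisj a' a).symm), Q.inner_eq h h',
    inner_conj_symm]
  ring

theorem concat_apply_left (hdisj : ∀ a a', e₀ a ≠ e₁ a') (h : Q.carrier)
    (x : lp (fun a => K (e₀ a)) 2) (a : α) :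
    concat Q e₀ e₁ c hc h x (e₀ a) = ⟪Q.vacuum, h⟫_ℂ • x a := by
  have h₁ : e₀ a ∉ Set.range e₁ := by rintro ⟨a', ha'⟩; exact hdisj a a' ha'.symm
  change ⟪Q.vacuum, h⟫_ℂ • push e₀ x (e₀ a) + push e₁ (mapLp c hc (Q.proj h) x) (e₀ a) = _
  rw [push_of_notMem e₁ _ h₁, push_apply, add_zero]

theorem concat_apply_right (hdisj : ∀ a a', e₀ a ≠ e₁ a') (h : Q.carrier)
    (x : lp (fun a => K (e₀ a)) 2) (a : α) :
    concat Q e₀ e₁ c hc h x (e₁ a) = c a (Q.proj h) (x a) := by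
  have h₀ : e₁ a ∉ Set.range e₀ := by rintro ⟨a', ha'⟩; exact hdisj a' a ha'
  change ⟪Q.vacuum, h⟫_ℂ • push e₀ x (e₁ a) + push e₁ (mapLp c hc (Q.proj h) x) (e₁ a) = _
  rw [push_of_notMem e₀ _ h₀, push_apply, smul_zero, zero_add]
  rfl

end Concat

/-- A Hilbert space, bundled so that families can be defined by recursion. -/
structure HilbertSpace where
  carrier : Type u
  [normedAddCommGroup : NormedAddCommGroup carrier]
  [innerProductSpace : InnerProductSpace ℂ carrier]
  [completeSpace : CompleteSpace carrier]

attribute [instance] HilbertSpace.normedAddCommGroup HilbertSpace.innerProductSpace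
  HilbertSpace.completeSpace

variable {I : Type v} (P : I → PointedHilbert.{u})

/-- For `w = [i₁, …, iₙ]`, the Hilbert space tensor product `H°_{i₁} ⊗ ⋯ ⊗ H°_{iₙ}`, where
`H°_i` is the orthogonal complement of the distinguished vector; for the empty list, the
one-dimensional space. -/
def wordHilbert : List I → HilbertSpace.{u}
  | [] => ⟨EuclideanSpace ℂ PUnit.{u + 1}⟩
  | i :: w => ⟨HilbertTensor (P i).reduced (wordHilbert w).carrier⟩

/-- The Hilbert space of a word. -/
abbrev WordSpace (w : List I) : Type u := (wordHilbert P w).carrier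

/-- The map `(h, t) ↦ h ⊗ t` from `H°_i × (H°_{i₁} ⊗ ⋯ ⊗ H°_{iₙ})` to
`H°_i ⊗ H°_{i₁} ⊗ ⋯ ⊗ H°_{iₙ}`. -/
def consTensor (i : I) (w : List I) :
    (P i).reduced →ₗ[ℂ] WordSpace P w →ₗ[ℂ] WordSpace P (i :: w) :=
  (htmul : (P i).reduced →ₗ[ℂ] WordSpace P w →ₗ[ℂ] HilbertTensor (P i).reduced (WordSpace P w))

/-- The map `(h, t) ↦ t ⊗ h` from `H°_i × (H°_{i₁} ⊗ ⋯ ⊗ H°_{iₙ})` to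
`H°_{i₁} ⊗ ⋯ ⊗ H°_{iₙ} ⊗ H°_i`, by recursion on the word. -/
def snocTensor (i : I) :
    (w : List I) → (P i).reduced →ₗ[ℂ] WordSpace P w →L[ℂ] WordSpace P (w ++ [i])
  | [] => (htmulL : (P i).reduced →ₗ[ℂ] WordSpace P [] →L[ℂ]
      HilbertTensor (P i).reduced (WordSpace P []))
  | j :: w => (hmapRight.comp (snocTensor i w) : (P i).reduced →ₗ[ℂ]
      HilbertTensor (P j).reduced (WordSpace P w) →L[ℂ]
      HilbertTensor (P j).reduced (WordSpace P (w ++ [i])))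

theorem inner_consTensor (i : I) (w : List I) (h h' : (P i).reduced) (t t' : WordSpace P w) :
    ⟪consTensor P i w h t, consTensor P i w h' t'⟫_ℂ = ⟪h, h'⟫_ℂ * ⟪t, t'⟫_ℂ :=
  inner_htmul h h' t t'

theorem inner_snocTensor (i : I) (w : List I) (h h' : (P i).reduced) (t t' : WordSpace P w) :
    ⟪snocTensor P i w h t, snocTensor P i w h' t'⟫_ℂ = ⟪h, h'⟫_ℂ * ⟪t, t'⟫_ℂ := by
  induction w with
  | nil => exact inner_htmul h h' t t'
  | cons j w ih => exact inner_hmap_id (fun y y' => ih y y') t t'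

/-- The alternating words `i₁ ≠ i₂ ≠ ⋯ ≠ iₙ`, including the empty one. -/
abbrev AltWord (I : Type v) : Type v := {w : List I // w.IsChain (· ≠ ·)}

/-- The alternating words that do not start with `i`. -/
abbrev AltWordL (i : I) : Type v := {w : AltWord I // w.1.head? ≠ some i}

/-- The alternating words that do not end with `i`. -/
abbrev AltWordR (i : I) : Type v := {w : AltWord I // w.1.getLast? ≠ some i}

/-- Putting the letter `i` in front of a word. -/
def consWord (i : I) : AltWordL i ↪ AltWord I where
  toFun w := ⟨i :: w.1.1, by
    refine List.isChain_cons.mpr ⟨fun j hj hij => w.2 ?_, w.1.2⟩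
    exact hj.trans (congrArg some hij.symm)⟩
  inj' w w' h := Subtype.ext (Subtype.ext (List.cons_injective (congrArg Subtype.val h)))

/-- Putting the letter `i` at the end of a word. -/
def snocWord (i : I) : AltWordR i ↪ AltWord I where
  toFun w := ⟨w.1.1 ++ [i], by
    refine List.isChain_append.mpr ⟨w.1.2, List.isChain_singleton i, fun j hj k hk hjk => w.2 ?_⟩
    obtain rfl : i = k := by simpa using hk
    exact hj.trans (congrArg some hjk)⟩
  inj' w w' h := Subtype.ext (Subtype.ext (List.append_left_injective [i] (congrArg Subtype.val h)))

theorem ne_consWord (i : I) (w w' : AltWordL i) : w.1 ≠ consWord i w' := fun h =>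
  w.2 (by rw [h]; rfl)

theorem ne_snocWord (i : I) (w w' : AltWordR i) : w.1 ≠ snocWord i w' := fun h =>
  w.2 (by rw [h]; exact List.getLast?_concat)

/-- The free product Hilbert space `H = ℂξ ⊕ ⨁ H°_{i₁} ⊗ ⋯ ⊗ H°_{iₙ}`. -/
abbrev FreeProduct : Type (max u v) := lp (fun w : AltWord I => WordSpace P w.1) 2

/-- The Hilbert space `H(l, i)`: the partial sum over the words that do not start with `i`. -/
abbrev FreeProductL (i : I) : Type (max u v) := lp (fun w : AltWordL i => WordSpace P w.1.1) 2

/-- The Hilbert space `H(r, i)`: the partial sum over the words that do not end with `i`. -/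
abbrev FreeProductR (i : I) : Type (max u v) := lp (fun w : AltWordR i => WordSpace P w.1.1) 2

open Classical in
/-- The distinguished vector `ξ` of the free product. -/
def freeVacuum : FreeProduct P :=
  lp.single 2 (⟨[], List.isChain_nil⟩ : AltWord I)
    (EuclideanSpace.single PUnit.unit (1 : ℂ) : EuclideanSpace ℂ PUnit.{u + 1})

theorem norm_freeVacuum : ‖freeVacuum P‖ = 1 := by
  classical
  have h : ‖(EuclideanSpace.single PUnit.unit (1 : ℂ) : EuclideanSpace ℂ PUnit.{u + 1})‖ = 1 := by
    simp
  exact (lp.norm_single (by norm_num) _ _).trans h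

/-- The concatenation map `H_i × H(l, i) → H`, `(h, x) ↦ h ⊗ x`, where the distinguished vectors
of `H_i` and of `H(l, i)` are absorbed. -/
def leftConcat (i : I) : (P i).carrier →ₗ[ℂ] FreeProductL P i →ₗ[ℂ] FreeProduct P :=
  concat (K := fun w : AltWord I => WordSpace P w.1) (P i) (Function.Embedding.subtype _)
    (consWord i) (fun w => consTensor P i w.1.1) (fun w => inner_consTensor P i w.1.1)

theorem inner_leftConcat (i : I) (h h' : (P i).carrier) (x x' : FreeProductL P i) :
    ⟪leftConcat P i h x, leftConcat P i h' x'⟫_ℂ = ⟪h, h'⟫_ℂ * ⟪x, x'⟫_ℂ :=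
  inner_concat _ _ _ _ _ (ne_consWord i) _ _ _ _

/-- The concatenation map `H_i × H(r, i) → H`, `(h, x) ↦ x ⊗ h`, where the distinguished vectors
of `H_i` and of `H(r, i)` are absorbed. -/
def rightConcat (i : I) : (P i).carrier →ₗ[ℂ] FreeProductR P i →ₗ[ℂ] FreeProduct P :=
  concat (K := fun w : AltWord I => WordSpace P w.1) (P i) (Function.Embedding.subtype _)
    (snocWord i) (fun w => ContinuousLinearMap.coeLM ℂ ∘ₗ snocTensor P i w.1.1)
    (fun w => inner_snocTensor P i w.1.1)

theorem inner_rightConcat (i : I) (h h' : (P i).carrier) (x x' : FreeProductR P i) :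
    ⟪rightConcat P i h x, rightConcat P i h' x'⟫_ℂ = ⟪h, h'⟫_ℂ * ⟪x, x'⟫_ℂ :=
  inner_concat _ _ _ _ _ (ne_snocWord i) _ _ _ _

/-- The concatenation unitary `V_i : H_i ⊗ H(l, i) → H`, as a linear isometry (it is onto since
every alternating word either does not start with `i` or is `i` followed by such a word). -/
def leftUnitary (i : I) : HilbertTensor (P i).carrier (FreeProductL P i) →ₗᵢ[ℂ] FreeProduct P :=
  hlift (leftConcat P i) (inner_leftConcat P i)

/-- The concatenation unitary `W_i : H(r, i) ⊗ H_i → H`, as a linear isometry (it is onto since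
every alternating word either does not end with `i` or is such a word followed by `i`). -/
def rightUnitary (i : I) : HilbertTensor (FreeProductR P i) (P i).carrier →ₗᵢ[ℂ] FreeProduct P :=
  hlift (rightConcat P i).flip
    (fun x x' h h' => (inner_rightConcat P i h h' x x').trans (mul_comm _ _))

/-- The left representation `λ_i(T) = V_i (T ⊗ 1) V_i*`. -/
def leftRep (i : I) (T : (P i).carrier →L[ℂ] (P i).carrier) : FreeProduct P →L[ℂ] FreeProduct P :=
  (leftUnitary P i).toContinuousLinearMap ∘L hmap T (.id ℂ _) ∘L
    (leftUnitary P i).toContinuousLinearMap.adjoint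

/-- The right representation `ρ_i(T) = W_i (1 ⊗ T) W_i*`. -/
def rightRep (i : I) (T : (P i).carrier →L[ℂ] (P i).carrier) : FreeProduct P →L[ℂ] FreeProduct P :=
  (rightUnitary P i).toContinuousLinearMap ∘L hmap (.id ℂ _) T ∘L
    (rightUnitary P i).toContinuousLinearMap.adjoint

end FreeProduct

/-! ### Families of pairs of faces -/

/-- A pair of faces: two unital C*-subalgebras of `A`. -/
structure PairOfFaces (A : Type u) [CStarAlgebra A] where
  left : StarSubalgebra ℂ A
  right : StarSubalgebra ℂ A
  isClosed_left : IsClosed (left : Set A)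
  isClosed_right : IsClosed (right : Set A)

section Faces

variable {A : Type u} [CStarAlgebra A]

instance (F : PairOfFaces A) : CStarAlgebra F.left :=
  StarSubalgebra.cstarAlgebra F.left (h_closed := F.isClosed_left)

instance (F : PairOfFaces A) : CStarAlgebra F.right :=
  StarSubalgebra.cstarAlgebra F.right (h_closed := F.isClosed_right)

/-- The C*-algebra `C*(A_l, A_r)` generated by a pair of faces. -/
def PairOfFaces.generated (F : PairOfFaces A) : StarSubalgebra ℂ A :=
  (F.left ⊔ F.right).topologicalClosure

instance (F : PairOfFaces A) : CStarAlgebra F.generated :=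
  StarSubalgebra.cstarAlgebra F.generated
    (h_closed := StarSubalgebra.isClosed_topologicalClosure _)

theorem PairOfFaces.left_le (F : PairOfFaces A) : F.left ≤ F.generated :=
  le_sup_left.trans (StarSubalgebra.le_topologicalClosure _)

theorem PairOfFaces.right_le (F : PairOfFaces A) : F.right ≤ F.generated :=
  le_sup_right.trans (StarSubalgebra.le_topologicalClosure _)

/-- The inclusion of the left face in the generated algebra. -/
def PairOfFaces.inl (F : PairOfFaces A) : F.left →⋆ₐ[ℂ] F.generated :=
  StarSubalgebra.inclusion F.left_le

/-- The inclusion of the right face in the generated algebra. -/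
def PairOfFaces.inr (F : PairOfFaces A) : F.right →⋆ₐ[ℂ] F.generated :=
  StarSubalgebra.inclusion F.right_le

variable {I : Type v} (φ : State A) (F : I → PairOfFaces A)

/-- A family of pairs of faces is non-trivial if it has at least two members and none of them
generates only the scalars. -/
def IsNontrivialFamily (F : I → PairOfFaces A) : Prop :=
  Nontrivial I ∧ ∀ i, (F i).generated ≠ ⊥

/-- The restriction `φ_i` of `φ` to the algebra generated by the `i`-th pair of faces. -/
def faceState (i : I) : State (F i).generated := φ.restrict (F i).generated

/-- The GNS space of `φ_i`, with its canonical cyclic vector. -/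
def faceHilbert (i : I) : PointedHilbert.{u} := (faceState φ F i).gns

/-- The GNS representation of `φ_i`. -/
def faceRep (i : I) :
    (F i).generated →⋆ₐ[ℂ] ((faceHilbert φ F i).carrier →L[ℂ] (faceHilbert φ F i).carrier) :=
  (faceState φ F i).rep

/-- The reduced bi-free product: the C*-algebra generated by the left faces, acting by
`λ_i ∘ π_i`, and the right faces, acting by `ρ_i ∘ π_i`, on the free product of the GNS spaces. -/
def biFreeProduct : StarSubalgebra ℂ
    (FreeProduct (faceHilbert φ F) →L[ℂ] FreeProduct (faceHilbert φ F)) :=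
  (StarAlgebra.adjoin ℂ
    ({T | ∃ (i : I) (a : (F i).left), T = leftRep _ i (faceRep φ F i ((F i).inl a))} ∪
      {T | ∃ (i : I) (b : (F i).right), T = rightRep _ i (faceRep φ F i ((F i).inr b))}
    )).topologicalClosure

/-- The bi-free product state `T ↦ ⟨T ξ, ξ⟩` on the reduced bi-free product. -/
def biFreeState : State (biFreeProduct φ F) where
  toFun T := ⟪freeVacuum (faceHilbert φ F), T.1 (freeVacuum (faceHilbert φ F))⟫_ℂ
  map_add' S T := inner_add_right _ _ _
  map_smul' c T := inner_smul_right _ _ _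
  map_one' := by
    change ⟪freeVacuum (faceHilbert φ F), freeVacuum (faceHilbert φ F)⟫_ℂ = 1
    rw [inner_self_eq_norm_sq_to_K, norm_freeVacuum]
    simp
  nonneg' T := by
    change 0 ≤ ⟪freeVacuum (faceHilbert φ F),
      (T.1.adjoint ∘L T.1) (freeVacuum (faceHilbert φ F))⟫_ℂ
    rw [ContinuousLinearMap.comp_apply, ContinuousLinearMap.adjoint_inner_right,
      inner_self_eq_norm_sq_to_K]
    norm_cast
    positivity

end Faces

end BiFree

end

/-!
If the bi-free product state is faithful, then the free vacuum `ξ` is a separating vector for the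
bi-free product. On `H_i ⊆ H` both `λ_i` and `ρ_i` act as `π_i`, and an element of the bi-free
product is determined by its restriction to `H_i`, which contains `ξ`. So `C_i` itself embeds in
the bi-free product, by a `θ_i` that extends `λ_i ∘ π_i` on the left face and `ρ_i ∘ π_i` on the
right one.

Choose `j ≠ i` and an invertible `c ∈ C_j` with `φ_j(c) = 0`. Then `θ_j(c) ξ` is a vector of
`H°_j` which is separating too, and after normalization it is a unit vector `k`. On
`H_i ⊗ k ⊗ H_i ⊆ H` the left face of `C_i` acts on the first leg and the right face on the last
one, so that the faces commute; as `ξ_i ⊗ k ⊗ ξ_i` is separating, `C_i` is represented faithfully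
on `H_i ⊗ H_i`, and the norm of the spatial tensor product can be computed there.
-/

noncomputable section

namespace BiFree

universe u v

section HilbertTensor

variable {E F G E' F' : Type*}
  [NormedAddCommGroup E] [InnerProductSpace ℂ E] [NormedAddCommGroup F] [InnerProductSpace ℂ F]
  [NormedAddCommGroup G] [NormedSpace ℂ G]
  [NormedAddCommGroup E'] [InnerProductSpace ℂ E'] [NormedAddCommGroup F'] [InnerProductSpace ℂ F']

theorem continuous_htmul : Continuous fun p : E × F => htmul p.1 p.2 :=
  ((htmul (E := E) (F := F)).mkContinuous₂ 1
    fun x y => by rw [norm_htmul, one_mul]).continuous₂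

theorem denseRange_lift_htmul {V W : Type*} [AddCommGroup V] [Module ℂ V] [AddCommGroup W]
    [Module ℂ W] {f : V →ₗ[ℂ] E} {g : W →ₗ[ℂ] F} (hf : DenseRange f) (hg : DenseRange g) :
    DenseRange (TensorProduct.lift (htmul.compl₁₂ f g)) := by
  set S := (LinearMap.range (TensorProduct.lift (htmul.compl₁₂ f g))).topologicalClosure
  have hS : IsClosed (S : Set (HilbertTensor E F)) := Submodule.isClosed_topologicalClosure _
  have htmul_mem : ∀ x y, htmul x y ∈ S := fun x y =>
    (hf.prodMap hg).induction_on (p := fun p : E × F => htmul p.1 p.2 ∈ S) (x, y)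
      (hS.preimage continuous_htmul) fun p =>
      Submodule.le_topologicalClosure _ ⟨p.1 ⊗ₜ p.2, TensorProduct.lift.tmul _ _⟩
  refine fun z => denseRange_toHilbertTensor.induction_on (p := (· ∈ S)) z hS fun t => ?_
  induction t using TensorProduct.induction_on with
  | zero => simp
  | add x y hx hy => rw [map_add]; exact S.add_mem hx hy
  | tmul x y => exact htmul_mem x y

theorem ext_htmul {S T : HilbertTensor E F →L[ℂ] G} (h : ∀ x y, S (htmul x y) = T (htmul x y)) :
    S = T :=
  ContinuousLinearMap.ext fun z => denseRange_toHilbertTensor.induction_on z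
    (isClosed_eq S.continuous T.continuous) fun t => congr($(TensorProduct.ext'
      (g := S.toLinearMap ∘ₗ toHilbertTensor.toLinearMap)
      (h := T.toLinearMap ∘ₗ toHilbertTensor.toLinearMap) h) t)

theorem eq_zero_of_forall_norm_eq_one {T : HilbertTensor E F →L[ℂ] G}
    (h : ∀ η ζ, ‖η‖ = 1 → ‖ζ‖ = 1 → T (htmul η ζ) = 0) : T = 0 :=
  ext_htmul fun η ζ => by
    rcases eq_or_ne η 0 with rfl | hη
    · simp
    rcases eq_or_ne ζ 0 with rfl | hζ
    · simp
    have h_unit := h _ _ (norm_smul_inv_norm (𝕜 := ℂ) hη) (norm_smul_inv_norm (𝕜 := ℂ) hζ)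
    simpa [hη, hζ] using h_unit

theorem hmap_comp_hmap {E'' F'' : Type*} [NormedAddCommGroup E''] [InnerProductSpace ℂ E'']
    [NormedAddCommGroup F''] [InnerProductSpace ℂ F''] (S' : E' →L[ℂ] E'') (T' : F' →L[ℂ] F'')
    (S : E →L[ℂ] E') (T : F →L[ℂ] F') :
    hmap S' T' ∘L hmap S T = hmap (S' ∘L S) (T' ∘L T) :=
  ext_htmul fun x y => by
    rw [ContinuousLinearMap.comp_apply, hmap_htmul, hmap_htmul, hmap_htmul]
    rfl

theorem adjoint_hmap [CompleteSpace E] [CompleteSpace F] [CompleteSpace E'] [CompleteSpace F']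
    (S : E →L[ℂ] E') (T : F →L[ℂ] F') : (hmap S T).adjoint = hmap S.adjoint T.adjoint :=
  ext_htmul fun x' y' => ext_inner_right ℂ fun z => by
    rw [ContinuousLinearMap.adjoint_inner_left]
    suffices innerSL ℂ (htmul x' y') ∘L hmap S T =
        innerSL ℂ (hmap S.adjoint T.adjoint (htmul x' y')) from congr($this z)
    refine ext_htmul fun x y => ?_
    simp only [ContinuousLinearMap.comp_apply, innerSL_apply_apply, hmap_htmul, inner_htmul,
      ContinuousLinearMap.adjoint_inner_left]

end HilbertTensor

section Compression

variable {C H K : Type*} [CStarAlgebra C]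
  [NormedAddCommGroup H] [InnerProductSpace ℂ H] [NormedAddCommGroup K] [InnerProductSpace ℂ K]

theorem linearIsometry_comp_injective (u : K →ₗᵢ[ℂ] H) :
    Function.Injective fun R : K →L[ℂ] K => u.toContinuousLinearMap ∘L R :=
  fun _ _ h => ContinuousLinearMap.ext fun k => u.injective congr($h k)

variable [CompleteSpace H] [CompleteSpace K]

theorem adjoint_comp_linearIsometry (u : K →ₗᵢ[ℂ] H) :
    u.toContinuousLinearMap.adjoint ∘L u.toContinuousLinearMap = .id ℂ K :=
  (ContinuousLinearMap.norm_map_iff_adjoint_comp_self _).mp u.norm_map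

theorem adjoint_linearIsometry_apply (u : K →ₗᵢ[ℂ] H) (k : K) :
    u.toContinuousLinearMap.adjoint (u k) = k :=
  congr($(adjoint_comp_linearIsometry u) k)

/-- The operators on `H` for which the range of the isometry `u` is a reducing subspace, encoded
as the commutant of the projection `u u*` on that range. -/
def reducing (u : K →ₗᵢ[ℂ] H) : StarSubalgebra ℂ (H →L[ℂ] H) :=
  StarSubalgebra.centralizer ℂ {u.toContinuousLinearMap ∘L u.toContinuousLinearMap.adjoint}

theorem isClosed_reducing (u : K →ₗᵢ[ℂ] H) : IsClosed (reducing u : Set (H →L[ℂ] H)) :=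
  Set.isClosed_centralizer _

theorem mem_reducing_iff {u : K →ₗᵢ[ℂ] H} {T : H →L[ℂ] H} :
    T ∈ reducing u ↔ u.toContinuousLinearMap ∘L u.toContinuousLinearMap.adjoint ∘L T =
      T ∘L u.toContinuousLinearMap ∘L u.toContinuousLinearMap.adjoint := by
  have isSelfAdjoint_proj : star (u.toContinuousLinearMap ∘L u.toContinuousLinearMap.adjoint) =
      u.toContinuousLinearMap ∘L u.toContinuousLinearMap.adjoint := by
    rw [ContinuousLinearMap.star_eq_adjoint, ContinuousLinearMap.adjoint_comp,
      ContinuousLinearMap.adjoint_adjoint]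
  simp only [reducing, StarSubalgebra.mem_centralizer_iff, Set.mem_singleton_iff, forall_eq,
    isSelfAdjoint_proj, and_self]
  rfl

theorem mem_reducing_of_intertwines {u : K →ₗᵢ[ℂ] H} {T : H →L[ℂ] H} {R : K →L[ℂ] K}
    (h : T ∘L u.toContinuousLinearMap = u.toContinuousLinearMap ∘L R)
    (h_adjoint : T.adjoint ∘L u.toContinuousLinearMap = u.toContinuousLinearMap ∘L R.adjoint) :
    T ∈ reducing u := by
  have adjoint_comp : u.toContinuousLinearMap.adjoint ∘L T =
      R ∘L u.toContinuousLinearMap.adjoint := by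
    simpa only [ContinuousLinearMap.adjoint_comp, ContinuousLinearMap.adjoint_adjoint] using
      congr(ContinuousLinearMap.adjoint $h_adjoint)
  rw [mem_reducing_iff, adjoint_comp, ← ContinuousLinearMap.comp_assoc, ← h,
    ContinuousLinearMap.comp_assoc]

theorem apply_adjoint_apply_of_mem_reducing {u : K →ₗᵢ[ℂ] H} {T : H →L[ℂ] H}
    (hT : T ∈ reducing u) (k : K) :
    u (u.toContinuousLinearMap.adjoint (T (u k))) = T (u k) := by
  refine congr($(mem_reducing_iff.mp hT) (u k)).trans ?_
  exact congrArg (fun y => T (u y)) (adjoint_linearIsometry_apply u k)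

/-- The restriction `T ↦ u* T u` of operators to a reducing subspace, viewed on the domain of the
isometry `u`. -/
def compression (u : K →ₗᵢ[ℂ] H) : reducing u →⋆ₐ[ℂ] (K →L[ℂ] K) where
  toFun T := u.toContinuousLinearMap.adjoint ∘L T.1 ∘L u.toContinuousLinearMap
  map_one' := adjoint_comp_linearIsometry u
  map_mul' S T := ContinuousLinearMap.ext fun k => congrArg
    (fun y => u.toContinuousLinearMap.adjoint (S.1 y))
    (apply_adjoint_apply_of_mem_reducing T.2 k).symm
  map_zero' := ContinuousLinearMap.ext fun _ => map_zero u.toContinuousLinearMap.adjoint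
  map_add' _ _ := ContinuousLinearMap.ext fun _ => map_add u.toContinuousLinearMap.adjoint _ _
  commutes' r := ContinuousLinearMap.ext fun k =>
    (map_smul u.toContinuousLinearMap.adjoint r (u k)).trans
      (congrArg (r • ·) (adjoint_linearIsometry_apply u k))
  map_star' T := by
    change u.toContinuousLinearMap.adjoint ∘L T.1.adjoint ∘L u.toContinuousLinearMap =
      (u.toContinuousLinearMap.adjoint ∘L T.1 ∘L u.toContinuousLinearMap).adjoint
    rw [ContinuousLinearMap.adjoint_comp, ContinuousLinearMap.adjoint_comp,
      ContinuousLinearMap.adjoint_adjoint, ContinuousLinearMap.comp_assoc]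

theorem map_compression_apply (u : K →ₗᵢ[ℂ] H) (T : reducing u) (k : K) :
    u (compression u T k) = T.1 (u k) :=
  apply_adjoint_apply_of_mem_reducing T.2 k

theorem compression_eq_of_comp_eq {u : K →ₗᵢ[ℂ] H} {T : reducing u} {R : K →L[ℂ] K}
    (h : T.1 ∘L u.toContinuousLinearMap = u.toContinuousLinearMap ∘L R) : compression u T = R :=
  linearIsometry_comp_injective u <|
    (ContinuousLinearMap.ext (map_compression_apply u T)).trans h

theorem exists_starAlgHom_comp_eq {A B E : Type*} [Semiring A] [StarRing A] [Algebra ℂ A]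
    [Semiring B] [StarRing B] [Algebra ℂ B] [StarModule ℂ B]
    [Semiring E] [StarRing E] [Algebra ℂ E]
    {κ : E →⋆ₐ[ℂ] B} (hκ : Function.Injective κ) {π : A →⋆ₐ[ℂ] B} (hπ : ∀ a, π a ∈ κ.range) :
    ∃ θ : A →⋆ₐ[ℂ] E, κ.comp θ = π := by
  let e := StarAlgEquiv.ofInjective κ hκ
  refine ⟨(e.symm : κ.range →⋆ₐ[ℂ] E).comp (π.codRestrict κ.range hπ), StarAlgHom.ext fun a => ?_⟩
  exact congrArg Subtype.val (e.apply_symm_apply (π.codRestrict κ.range hπ a))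

theorem eq_top_of_isClosed_of_subset {A : Type*} [TopologicalSpace A] [Semiring A] [StarRing A]
    [Algebra ℂ A] [StarModule ℂ A] [IsTopologicalSemiring A] [ContinuousStar A] {s : Set A}
    (hs : (StarAlgebra.adjoin ℂ s).topologicalClosure = ⊤) {S : StarSubalgebra ℂ A}
    (hS : IsClosed (S : Set A)) (h : s ⊆ S) : S = ⊤ :=
  top_le_iff.mp (hs ▸ StarSubalgebra.topologicalClosure_minimal (StarAlgebra.adjoin_le h) hS)

open scoped CStarAlgebra in
theorem exists_restriction {θ : C →⋆ₐ[ℂ] (H →L[ℂ] H)} {u : K →ₗᵢ[ℂ] H} {s : Set C}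
    (hs : (StarAlgebra.adjoin ℂ s).topologicalClosure = ⊤)
    (hθ : ∀ c ∈ s, ∃ R, θ c ∘L u.toContinuousLinearMap = u.toContinuousLinearMap ∘L R ∧
      (θ c).adjoint ∘L u.toContinuousLinearMap = u.toContinuousLinearMap ∘L R.adjoint) :
    ∃ σ : C →⋆ₐ[ℂ] (K →L[ℂ] K),
      ∀ c, θ c ∘L u.toContinuousLinearMap = u.toContinuousLinearMap ∘L σ c := by
  have comap_eq_top : (reducing u).comap θ = ⊤ :=
    eq_top_of_isClosed_of_subset hs ((isClosed_reducing u).preimage (map_continuous θ))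
      fun c hc => by
        obtain ⟨R, hR, hR_adjoint⟩ := hθ c hc
        exact mem_reducing_of_intertwines hR hR_adjoint
  refine ⟨(compression u).comp (θ.codRestrict (reducing u) fun c =>
    (comap_eq_top ▸ StarSubalgebra.mem_top : c ∈ (reducing u).comap θ)),
    fun c => ContinuousLinearMap.ext fun k => ?_⟩
  exact (map_compression_apply u ⟨θ c, _⟩ k).symm

open scoped CStarAlgebra in
/-- Compression to a reducing subspace containing a separating vector is isometric, so it can be
inverted on the closed algebra it maps onto. -/
theorem exists_dilation {D : StarSubalgebra ℂ (H →L[ℂ] H)} (hD : IsClosed (D : Set (H →L[ℂ] H)))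
    {u : K →ₗᵢ[ℂ] H} {k : K} (hk : ∀ T ∈ D, T (u k) = 0 → T = 0)
    {s : Set C} (hs : (StarAlgebra.adjoin ℂ s).topologicalClosure = ⊤) {π : C →⋆ₐ[ℂ] (K →L[ℂ] K)}
    (hπ : ∀ c ∈ s, ∃ T ∈ D, T ∘L u.toContinuousLinearMap = u.toContinuousLinearMap ∘L π c ∧
      T.adjoint ∘L u.toContinuousLinearMap = u.toContinuousLinearMap ∘L (π c).adjoint) :
    ∃ θ : C →⋆ₐ[ℂ] D,
      ∀ c, (θ c).1 ∘L u.toContinuousLinearMap = u.toContinuousLinearMap ∘L π c := by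
  let E := D ⊓ reducing u
  have hE : IsClosed (E : Set (H →L[ℂ] H)) := hD.inter (isClosed_reducing u)
  let _ : CStarAlgebra E := StarSubalgebra.cstarAlgebra E (h_closed := hE)
  let κ : E →⋆ₐ[ℂ] (K →L[ℂ] K) :=
    (compression u).comp (StarSubalgebra.inclusion (inf_le_right : E ≤ reducing u))
  have apply_κ (T : E) (k : K) : u (κ T k) = T.1 (u k) := map_compression_apply u _ k
  have κ_injective : Function.Injective κ := (injective_iff_map_eq_zero κ).mpr fun T hT =>
    Subtype.ext (hk T.1 T.2.1 (by rw [← apply_κ, hT, zero_apply, map_zero]))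
  have isClosed_range : IsClosed (κ.range : Set (K →L[ℂ] K)) :=
    (NonUnitalStarAlgHom.isometry κ κ_injective).isClosedEmbedding.isClosed_range
  have comap_eq_top : κ.range.comap π = ⊤ :=
    eq_top_of_isClosed_of_subset hs (isClosed_range.preimage (map_continuous π))
      fun c hc => by
        obtain ⟨T, hTD, hT, hT_adjoint⟩ := hπ c hc
        exact ⟨⟨T, hTD, mem_reducing_of_intertwines hT hT_adjoint⟩,
          compression_eq_of_comp_eq (T := ⟨T, _⟩) hT⟩
  obtain ⟨θ, hθ⟩ := exists_starAlgHom_comp_eq κ_injective (π := π) fun c =>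
    (comap_eq_top ▸ StarSubalgebra.mem_top : c ∈ κ.range.comap π)
  refine ⟨(StarSubalgebra.inclusion inf_le_left).comp θ,
    fun c => ContinuousLinearMap.ext fun k => ?_⟩
  exact (apply_κ (θ c) k).symm.trans congr(u ($hθ c k))

end Compression

section GNS

variable {A : Type u} [CStarAlgebra A] (φ : State A)

theorem State.map_one : φ 1 = 1 := φ.map_one'

/-- The map `a ↦ π_φ(a) ξ_φ` of a C*-algebra to the GNS space of a state. -/
def State.toGNS : A →ₗ[ℂ] φ.gns.carrier where
  toFun a := φ.rep a φ.gns.vacuum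
  map_add' a b := by rw [map_add, add_apply]
  map_smul' c a := by rw [map_smul, smul_apply, RingHom.id_apply]

theorem State.toGNS_apply (a : A) : φ.toGNS a = φ.rep a φ.gns.vacuum := rfl

theorem State.toGNS_one : φ.toGNS 1 = φ.gns.vacuum := by
  rw [φ.toGNS_apply, _root_.map_one, one_apply_eq_self]

theorem State.rep_toGNS (a b : A) : φ.rep a (φ.toGNS b) = φ.toGNS (a * b) := by
  rw [φ.toGNS_apply, φ.toGNS_apply, map_mul, mul_apply_eq_comp]

theorem State.continuous_toGNS : Continuous φ.toGNS :=
  (φ.toGNS.mkContinuous ‖φ.gns.vacuum‖ fun a => by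
    rw [mul_comm, φ.toGNS_apply]
    exact (φ.rep a).le_of_opNorm_le (NonUnitalStarAlgHom.norm_apply_le φ.rep a) _).continuous

theorem State.toGNS_eq_coe (a : A) :
    letI := CStarAlgebra.spectralOrder A
    letI := CStarAlgebra.spectralOrderedRing A
    φ.toGNS a = ((φ.toPositive.toPreGNS a : φ.toPositive.PreGNS) : φ.toPositive.GNS) := by
  let _ := CStarAlgebra.spectralOrder A
  let _ := CStarAlgebra.spectralOrderedRing A
  refine (PositiveLinearMap.gnsNonUnitalStarAlgHom_apply_coe (f := φ.toPositive) (a := a)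
    (b := φ.toPositive.toPreGNS 1)).trans ?_
  rw [PositiveLinearMap.leftMulMapPreGNS_apply, PositiveLinearMap.ofPreGNS_toPreGNS, mul_one]

theorem State.inner_toGNS (a b : A) : ⟪φ.toGNS a, φ.toGNS b⟫_ℂ = φ (star a * b) := by
  let _ := CStarAlgebra.spectralOrder A
  let _ := CStarAlgebra.spectralOrderedRing A
  rw [φ.toGNS_eq_coe, φ.toGNS_eq_coe]
  exact UniformSpace.Completion.inner_coe _ _

theorem State.denseRange_toGNS : DenseRange φ.toGNS := by
  let _ := CStarAlgebra.spectralOrder A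
  let _ := CStarAlgebra.spectralOrderedRing A
  rw [funext φ.toGNS_eq_coe]
  exact (UniformSpace.Completion.denseRange_coe (α := φ.toPositive.PreGNS)).comp
    φ.toPositive.toPreGNS.surjective.denseRange (UniformSpace.Completion.continuous_coe _)

theorem State.map_star (a : A) : φ (star a) = starRingEnd ℂ (φ a) := by
  rw [← mul_one (star a), ← φ.inner_toGNS, ← inner_conj_symm, φ.inner_toGNS, star_one, one_mul]

theorem State.map_star_mul_self (a : A) : φ (star a * a) = (‖φ.toGNS a‖ ^ 2 : ℝ) := by
  rw [← φ.inner_toGNS, inner_self_eq_norm_sq_to_K]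
  push_cast
  rfl

variable {φ}

theorem State.IsFaithful.toGNS_injective (hφ : φ.IsFaithful) : Function.Injective φ.toGNS :=
  (injective_iff_map_eq_zero _).mpr fun a ha => hφ a (by rw [← φ.inner_toGNS, ha, inner_zero_left])

theorem State.IsFaithful.rep_injective (hφ : φ.IsFaithful) : Function.Injective φ.rep :=
  fun _ _ h => hφ.toGNS_injective congr($h φ.gns.vacuum)

theorem State.exists_isSelfAdjoint_of_reduced_ne_bot (h : φ.gns.reduced ≠ ⊥) :
    ∃ a, IsSelfAdjoint a ∧ φ a = 0 ∧ φ (a * a) ≠ 0 := by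
  by_contra! eq_zero
  refine h (Submodule.orthogonal_eq_bot_iff.mpr ?_)
  have mem_of_isSelfAdjoint {a : A} (ha : IsSelfAdjoint a) : φ.toGNS a ∈ ℂ ∙ φ.gns.vacuum := by
    have hsa : IsSelfAdjoint (a - φ a • 1) := by
      rw [isSelfAdjoint_iff, star_sub, star_smul, star_one, ha.star_eq, ← starRingEnd_apply,
        ← φ.map_star, ha.star_eq]
    have h_sq : φ (star (a - φ a • 1) * (a - φ a • 1)) = 0 :=
      hsa.star_eq.symm ▸ eq_zero _ hsa (by simp [φ.map_one])
    rw [φ.map_star_mul_self, Complex.ofReal_eq_zero, sq_eq_zero_iff, norm_eq_zero, map_sub,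
      map_smul, φ.toGNS_one, sub_eq_zero] at h_sq
    exact h_sq ▸ Submodule.smul_mem _ _ (Submodule.mem_span_singleton_self _)
  have toGNS_mem (a : A) : φ.toGNS a ∈ ℂ ∙ φ.gns.vacuum := by
    rw [← realPart_add_I_smul_imaginaryPart a, map_add, map_smul]
    exact add_mem (mem_of_isSelfAdjoint (realPart a).2)
      (Submodule.smul_mem _ _ (mem_of_isSelfAdjoint (imaginaryPart a).2))
  exact Submodule.eq_top_iff'.mpr fun x => φ.denseRange_toGNS.induction_on
    (p := (· ∈ ℂ ∙ φ.gns.vacuum)) x (ℂ ∙ φ.gns.vacuum).closed_of_finiteDimensional toGNS_mem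

open Polynomial in
theorem isUnit_add_I_smul_sq_sub [Nontrivial A] {a : A} (ha : IsSelfAdjoint a) {m : ℝ}
    (hm : m ≠ 0) : IsUnit (a + Complex.I • (a ^ 2 - (m : ℂ) • 1)) := by
  have h_aeval : a + Complex.I • (a ^ 2 - (m : ℂ) • 1) =
      aeval a (X + Complex.I • (X ^ 2 - C (m : ℂ))) := by
    simp only [map_add, map_smul, map_sub, map_pow, aeval_X, aeval_C,
      Algebra.algebraMap_eq_smul_one]
  rw [h_aeval, ← spectrum.zero_notMem_iff ℂ, spectrum.map_polynomial_aeval]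
  rintro ⟨t, ht, h_eval⟩
  obtain ⟨s, rfl⟩ : ∃ s : ℝ, t = s := ⟨t.re, ha.mem_spectrum_eq_re ht⟩
  have h_eval : (s : ℂ) + Complex.I * (s ^ 2 - m) = 0 := by simpa using h_eval
  have hs : s = 0 := by simpa [← Complex.ofReal_pow] using congr(Complex.re $h_eval)
  have : s ^ 2 - m = 0 := by simpa [← Complex.ofReal_pow] using congr(Complex.im $h_eval)
  exact hm (by rw [hs] at this; linarith)

/-- If `a` is selfadjoint with `φ(a) = 0` and `m = φ(a²) ≠ 0`, then `z = a + i (a² - m)` is killed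
by `φ`, and it is invertible because `t + i (t² - m)` does not vanish for real `t`. -/
theorem State.exists_isUnit_map_eq_zero (h : φ.gns.reduced ≠ ⊥) : ∃ z, IsUnit z ∧ φ z = 0 := by
  obtain ⟨a, ha, h_map, h_sq⟩ := State.exists_isSelfAdjoint_of_reduced_ne_bot h
  have : Nontrivial A := ⟨a * a, 0, fun h0 => h_sq (by rw [h0, map_zero])⟩
  have h_real : φ (a * a) = (‖φ.toGNS a‖ ^ 2 : ℝ) := by
    rw [← φ.map_star_mul_self, ha.star_eq]
  refine ⟨_, isUnit_add_I_smul_sq_sub ha (m := ‖φ.toGNS a‖ ^ 2)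
    fun h0 => h_sq (by rw [h_real, h0, Complex.ofReal_zero]), ?_⟩
  rw [map_add, map_smul, map_sub, map_smul, h_map, sq, h_real, φ.map_one]
  simp

theorem State.toGNS_mem_reduced {a : A} : φ.toGNS a ∈ φ.gns.reduced ↔ φ a = 0 := by
  rw [Submodule.mem_orthogonal_singleton_iff_inner_right, ← φ.toGNS_one, φ.inner_toGNS, star_one,
    one_mul]

theorem State.IsFaithful.eq_smul_one_of_reduced_eq_bot (hφ : φ.IsFaithful)
    (h : φ.gns.reduced = ⊥) (a : A) : a = φ a • 1 := by
  have mem_reduced : φ.toGNS (a - φ a • 1) ∈ φ.gns.reduced := State.toGNS_mem_reduced.mpr (by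
    rw [map_sub, map_smul, φ.map_one, smul_eq_mul, mul_one, sub_self])
  rw [h, Submodule.mem_bot] at mem_reduced
  exact sub_eq_zero.mp (hφ.toGNS_injective (mem_reduced.trans (map_zero _).symm))

theorem State.toGNS_ne_zero_of_isUnit {z : A} (hz : IsUnit z) : φ.toGNS z ≠ 0 := by
  obtain ⟨y, hy⟩ := hz.exists_left_inv
  intro h
  have norm_vacuum := φ.gns.norm_vacuum
  rw [← φ.toGNS_one, ← hy, ← φ.rep_toGNS, h, map_zero, norm_zero] at norm_vacuum
  exact zero_ne_one norm_vacuum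

theorem State.exists_isUnit_norm_toGNS_eq_one (h : φ.gns.reduced ≠ ⊥) :
    ∃ z, IsUnit z ∧ φ.toGNS z ∈ φ.gns.reduced ∧ ‖φ.toGNS z‖ = 1 := by
  obtain ⟨z, hz, h_map⟩ := State.exists_isUnit_map_eq_zero h
  have toGNS_ne_zero := State.toGNS_ne_zero_of_isUnit (φ := φ) hz
  refine ⟨(‖φ.toGNS z‖ : ℂ)⁻¹ • z, ?_, ?_, ?_⟩
  · exact hz.smul (Units.mk0 (‖φ.toGNS z‖ : ℂ)⁻¹ (by simpa using toGNS_ne_zero))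
  · rw [map_smul]
    exact Submodule.smul_mem _ _ (State.toGNS_mem_reduced.mpr h_map)
  · exact (congrArg norm (map_smul _ _ _)).trans (norm_smul_inv_norm toGNS_ne_zero)

end GNS

section NumericalRadius

variable {A B : Type*} [CStarAlgebra A] [CStarAlgebra B] {H K : Type*}
  [NormedAddCommGroup H] [InnerProductSpace ℂ H] [CompleteSpace H]
  [NormedAddCommGroup K] [InnerProductSpace ℂ K] [CompleteSpace K]

/-- The functional `a ↦ ⟪η, π(a) η⟫` of a vector `η`. -/
def vectorFunctional (π : A →⋆ₐ[ℂ] (H →L[ℂ] H)) (η : H) : A →ₗ[ℂ] ℂ :=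
  (innerSL ℂ η).toLinearMap ∘ₗ (ContinuousLinearMap.apply ℂ H η).toLinearMap ∘ₗ π.toLinearMap

theorem vectorFunctional_apply (π : A →⋆ₐ[ℂ] (H →L[ℂ] H)) (η : H) (a : A) :
    vectorFunctional π η a = ⟪η, π a η⟫_ℂ := rfl

theorem vectorFunctional_star_mul_self (π : A →⋆ₐ[ℂ] (H →L[ℂ] H)) (η : H) (a : A) :
    vectorFunctional π η (star a * a) = (‖π a η‖ ^ 2 : ℝ) := by
  rw [vectorFunctional_apply, map_mul, map_star, ContinuousLinearMap.star_eq_adjoint,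
    mul_apply_eq_comp, ContinuousLinearMap.adjoint_inner_right, inner_self_eq_norm_sq_to_K]
  push_cast
  rfl

/-- The vector state of a unit vector. -/
def vectorState (π : A →⋆ₐ[ℂ] (H →L[ℂ] H)) {η : H} (hη : ‖η‖ = 1) : State A where
  toLinearMap := vectorFunctional π η
  map_one' := by simpa [hη] using vectorFunctional_star_mul_self π η 1
  nonneg' a := (Complex.zero_le_real.mpr (sq_nonneg _)).trans_eq
    (vectorFunctional_star_mul_self π η a).symm

theorem State.nonneg_of_isPositive_map (φ : State A) {π : A →⋆ₐ[ℂ] (H →L[ℂ] H)}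
    (hπ : Function.Injective π) {k : A} (hk : (π k).IsPositive) : 0 ≤ φ k := by
  let _ := CStarAlgebra.spectralOrder A
  let _ := CStarAlgebra.spectralOrderedRing A
  have hsa : IsSelfAdjoint k := hπ ((StarHomClass.map_star π k).trans hk.isSelfAdjoint.star_eq)
  have k_nonneg : 0 ≤ k := by
    rw [StarOrderedRing.nonneg_iff_spectrum_nonneg (R := ℝ) k hsa, ← hsa.map_spectrum_real π hπ]
    exact fun x hx => SpectrumRestricts.nnreal_iff.mp hk.spectrumRestricts x hx
  obtain ⟨b, rfl⟩ := CStarAlgebra.nonneg_iff_eq_star_mul_self.mp k_nonneg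
  exact φ.nonneg' b

theorem State.re_le_of_forall_re_inner_le (φ : State A) {π : A →⋆ₐ[ℂ] (H →L[ℂ] H)}
    (hπ : Function.Injective π) {y : A} {N : ℝ} (h : ∀ η, (⟪η, π y η⟫_ℂ).re ≤ N * ‖η‖ ^ 2) :
    (φ y).re ≤ N := by
  have isPositive : (π ((2 * N : ℂ) • 1 - (y + star y))).IsPositive := by
    refine (ContinuousLinearMap.isPositive_iff_complex _).mpr fun η => ?_
    have h_inner : ⟪π ((2 * N : ℂ) • 1 - (y + star y)) η, η⟫_ℂ =
        (2 * (N * ‖η‖ ^ 2 - (⟪η, π y η⟫_ℂ).re) : ℝ) := by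
      have h_adjoint : π (star y) = (π y).adjoint := StarHomClass.map_star π y
      rw [map_sub, map_add, map_smul, _root_.map_one, h_adjoint, sub_apply, add_apply, smul_apply,
        one_apply_eq_self, inner_sub_left, inner_add_left, inner_smul_left,
        ContinuousLinearMap.adjoint_inner_left, inner_self_eq_norm_sq_to_K, ← inner_conj_symm,
        add_comm, Complex.add_conj]
      push_cast
      simp [mul_sub, mul_assoc, Complex.conj_ofNat]
    rw [h_inner]
    exact ⟨rfl, mul_nonneg zero_le_two (sub_nonneg.mpr (h η))⟩
  have h_map : φ ((2 * N : ℂ) • 1 - (y + star y)) = (2 * (N - (φ y).re) : ℝ) := by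
    rw [map_sub, map_add, map_smul, φ.map_one, φ.map_star, Complex.add_conj]
    push_cast
    simp [mul_sub]
  have := h_map ▸ φ.nonneg_of_isPositive_map hπ isPositive
  rw [Complex.zero_le_real] at this
  linarith

theorem State.norm_le_of_forall_norm_inner_le (φ : State A) {π : A →⋆ₐ[ℂ] (H →L[ℂ] H)}
    (hπ : Function.Injective π) {y : A} {N : ℝ} (h : ∀ η, ‖⟪η, π y η⟫_ℂ‖ ≤ N * ‖η‖ ^ 2) :
    ‖φ y‖ ≤ N := by
  obtain ⟨c, hc, h_mul⟩ := Complex.exists_norm_eq_mul_self (φ y)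
  have re_map : (φ (c • y)).re = ‖φ y‖ := by
    rw [map_smul, smul_eq_mul, ← h_mul, Complex.ofReal_re]
  refine re_map ▸ φ.re_le_of_forall_re_inner_le hπ fun η => ?_
  rw [map_smul, smul_apply, inner_smul_right]
  exact (Complex.re_le_norm _).trans (by rw [norm_mul, hc, one_mul]; exact h η)

theorem dualDistrib_eq_apply_lid {R M N : Type*} [CommSemiring R] [AddCommMonoid M] [Module R M]
    [AddCommMonoid N] [Module R N] (f : M →ₗ[R] R) (g : N →ₗ[R] R) (x : M ⊗[R] N) :
    TensorProduct.dualDistrib R M N (f ⊗ₜ g) x = g (TensorProduct.lid R N (f.rTensor N x)) :=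
  congr($(TensorProduct.ext' (g := TensorProduct.dualDistrib R M N (f ⊗ₜ g))
    (h := g ∘ₗ (TensorProduct.lid R N).toLinearMap ∘ₗ f.rTensor N) fun a b => by simp) x)

theorem dualDistrib_eq_apply_rid {R M N : Type*} [CommSemiring R] [AddCommMonoid M] [Module R M]
    [AddCommMonoid N] [Module R N] (f : M →ₗ[R] R) (g : N →ₗ[R] R) (x : M ⊗[R] N) :
    TensorProduct.dualDistrib R M N (f ⊗ₜ g) x = f (TensorProduct.rid R M (g.lTensor M x)) :=
  congr($(TensorProduct.ext' (g := TensorProduct.dualDistrib R M N (f ⊗ₜ g))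
    (h := f ∘ₗ (TensorProduct.rid R M).toLinearMap ∘ₗ g.lTensor M) fun a b => by
      simp [mul_comm]) x)

theorem norm_dualDistrib_state_le (φ : State A) (ψ : State B) {π : A →⋆ₐ[ℂ] (H →L[ℂ] H)}
    (hπ : Function.Injective π) {ρ : B →⋆ₐ[ℂ] (K →L[ℂ] K)} (hρ : Function.Injective ρ)
    {x : A ⊗[ℂ] B} {N : ℝ}
    (h : ∀ η ζ, ‖TensorProduct.dualDistrib ℂ A B
      (vectorFunctional π η ⊗ₜ vectorFunctional ρ ζ) x‖ ≤ N * ‖η‖ ^ 2 * ‖ζ‖ ^ 2) :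
    ‖TensorProduct.dualDistrib ℂ A B (φ.toLinearMap ⊗ₜ ψ.toLinearMap) x‖ ≤ N := by
  rw [dualDistrib_eq_apply_lid]
  refine ψ.norm_le_of_forall_norm_inner_le hρ fun ζ => ?_
  rw [← vectorFunctional_apply, ← dualDistrib_eq_apply_lid, dualDistrib_eq_apply_rid]
  refine φ.norm_le_of_forall_norm_inner_le hπ fun η => ?_
  rw [← vectorFunctional_apply, ← dualDistrib_eq_apply_rid]
  exact (h η ζ).trans_eq (mul_right_comm _ _ _)

end NumericalRadius

section SpatialTensor

variable {A B : Type u} [CStarAlgebra A] [CStarAlgebra B] {C : Type*} [CStarAlgebra C]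
  {H K : Type*} [NormedAddCommGroup H] [InnerProductSpace ℂ H] [CompleteSpace H]
  [NormedAddCommGroup K] [InnerProductSpace ℂ K] [CompleteSpace K]
  {α : A →⋆ₐ[ℂ] C} {β : B →⋆ₐ[ℂ] C}

/-- The multiplication map `a ⊗ b ↦ α(a) β(b)` on the algebraic tensor product. -/
def mulMap (hcomm : ∀ a b, Commute (α a) (β b)) : A ⊗[ℂ] B →ₐ[ℂ] C :=
  Algebra.TensorProduct.lift α.toAlgHom β.toAlgHom hcomm

theorem mulMap_tmul (hcomm : ∀ a b, Commute (α a) (β b)) (a : A) (b : B) :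
    mulMap hcomm (a ⊗ₜ b) = α a * β b :=
  Algebra.TensorProduct.lift_tmul _ _ _ _ _

theorem mulMap_star (hcomm : ∀ a b, Commute (α a) (β b)) (x : A ⊗[ℂ] B) :
    mulMap hcomm (star x) = star (mulMap hcomm x) := by
  induction x using TensorProduct.induction_on with
  | zero => simp only [star_zero, map_zero]
  | add x y hx hy => rw [star_add, map_add, map_add, star_add, hx, hy]
  | tmul a b =>
    rw [TensorProduct.star_tmul, mulMap_tmul, mulMap_tmul, map_star, map_star, star_mul,
      (hcomm a b).star_star.eq]

/-- The map `a ⊗ b ↦ a ⊗ b` from the algebraic tensor product to the tensor product of two GNS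
spaces. -/
def tensorToGNS (φ : State A) (ψ : State B) :
    A ⊗[ℂ] B →ₗ[ℂ] HilbertTensor φ.gns.carrier ψ.gns.carrier :=
  TensorProduct.lift (htmul.compl₁₂ φ.toGNS ψ.toGNS)

theorem tensorToGNS_tmul (φ : State A) (ψ : State B) (a : A) (b : B) :
    tensorToGNS φ ψ (a ⊗ₜ b) = htmul (φ.toGNS a) (ψ.toGNS b) :=
  TensorProduct.lift.tmul _ _

theorem denseRange_tensorToGNS (φ : State A) (ψ : State B) : DenseRange (tensorToGNS φ ψ) :=
  denseRange_lift_htmul φ.denseRange_toGNS ψ.denseRange_toGNS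

theorem inner_tensorToGNS (φ : State A) (ψ : State B) (x y : A ⊗[ℂ] B) :
    ⟪tensorToGNS φ ψ x, tensorToGNS φ ψ y⟫_ℂ =
      TensorProduct.dualDistrib ℂ A B (φ.toLinearMap ⊗ₜ ψ.toLinearMap) (star x * y) := by
  induction x using TensorProduct.induction_on with
  | zero => simp only [map_zero, inner_zero_left, star_zero, zero_mul]
  | add x₁ x₂ h₁ h₂ => simp only [map_add, inner_add_left, h₁, h₂, star_add, add_mul]
  | tmul a b =>
    induction y using TensorProduct.induction_on with
    | zero => simp only [map_zero, inner_zero_right, mul_zero]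
    | add y₁ y₂ h₁ h₂ => simp only [map_add, inner_add_right, h₁, h₂, mul_add]
    | tmul c d =>
      rw [tensorToGNS_tmul, tensorToGNS_tmul, inner_htmul, φ.inner_toGNS, ψ.inner_toGNS,
        TensorProduct.star_tmul, Algebra.TensorProduct.tmul_mul_tmul,
        TensorProduct.dualDistrib_apply]

theorem tensorToGNS_tmul_mul (φ : State A) (ψ : State B) (a : A) (b : B) (x : A ⊗[ℂ] B) :
    tensorToGNS φ ψ (a ⊗ₜ b * x) = hmap (φ.rep a) (ψ.rep b) (tensorToGNS φ ψ x) := by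
  induction x using TensorProduct.induction_on with
  | zero => simp only [mul_zero, map_zero]
  | add x y hx hy => rw [mul_add, map_add, map_add, map_add, hx, hy]
  | tmul c d =>
    rw [Algebra.TensorProduct.tmul_mul_tmul, tensorToGNS_tmul, tensorToGNS_tmul, hmap_htmul,
      φ.rep_toGNS, ψ.rep_toGNS]

variable {hcomm : ∀ a b, Commute (α a) (β b)}

theorem exists_productState (hd : DenseRange (mulMap hcomm)) {φ : State A} {ψ : State B}
    (h : ∀ x, ‖TensorProduct.dualDistrib ℂ A B (φ.toLinearMap ⊗ₜ ψ.toLinearMap) x‖ ≤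
      ‖mulMap hcomm x‖) :
    ∃ τ : State C, ∀ x, τ (mulMap hcomm x) =
      TensorProduct.dualDistrib ℂ A B (φ.toLinearMap ⊗ₜ ψ.toLinearMap) x := by
  set f := TensorProduct.dualDistrib ℂ A B (φ.toLinearMap ⊗ₜ ψ.toLinearMap)
  let g : C →L[ℂ] ℂ := f.extendOfNorm (mulMap hcomm).toLinearMap
  have g_mulMap (x) : g (mulMap hcomm x) = f x :=
    LinearMap.extendOfNorm_eq (f := f) (e := (mulMap hcomm).toLinearMap) hd
      ⟨1, fun x => (h x).trans_eq (one_mul _).symm⟩ x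
  have g_one : g 1 = 1 := by
    rw [← map_one (mulMap hcomm), g_mulMap, Algebra.TensorProduct.one_def,
      TensorProduct.dualDistrib_apply, φ.map_one, ψ.map_one, mul_one]
  have g_nonneg (c : C) : 0 ≤ g (star c * c) := by
    refine hd.induction_on c (isClosed_Ici.preimage (f := fun c => g (star c * c))
      (g.continuous.comp (continuous_star.mul continuous_id))) fun x => ?_
    rw [← mulMap_star, ← map_mul, g_mulMap, ← inner_tensorToGNS, inner_self_eq_norm_sq_to_K,
      ← RCLike.ofReal_pow]
    exact Complex.zero_le_real.mpr (sq_nonneg _)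
  exact ⟨⟨g.toLinearMap, g_one, g_nonneg⟩, g_mulMap⟩

theorem State.exists_gns_linearIsometryEquiv (τ : State C) {V : Type*} [AddCommGroup V]
    [Module ℂ V] {q : V →ₗ[ℂ] C} (hq : DenseRange q) {r : V →ₗ[ℂ] K} (hr : DenseRange r)
    (h : ∀ x, (‖r x‖ ^ 2 : ℂ) = τ (star (q x) * q x)) :
    ∃ U : τ.gns.carrier ≃ₗᵢ[ℂ] K, ∀ x, U (τ.toGNS (q x)) = r x := by
  have norm_eq (x : V) : ‖r x‖ = ‖τ.toGNS (q x)‖ := by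
    rw [← sq_eq_sq₀ (norm_nonneg _) (norm_nonneg _)]
    exact_mod_cast (h x).trans (τ.map_star_mul_self _)
  exact ⟨(LinearEquiv.refl ℂ V).extendOfIsometry (τ.toGNS ∘ₗ q) r
    (τ.denseRange_toGNS.comp hq τ.continuous_toGNS) hr norm_eq,
    LinearEquiv.extendOfIsometry_eq _ (τ.toGNS ∘ₗ q) _ _ _ _⟩

theorem exists_tensorRep (hd : DenseRange (mulMap hcomm)) {φ : State A} {ψ : State B}
    (h : ∀ x, ‖TensorProduct.dualDistrib ℂ A B (φ.toLinearMap ⊗ₜ ψ.toLinearMap) x‖ ≤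
      ‖mulMap hcomm x‖) :
    ∃ Φ : C →⋆ₐ[ℂ] GNSTensorOp A B (φ, ψ), ∀ a b, Φ (α a * β b) = hmap (φ.rep a) (ψ.rep b) := by
  obtain ⟨τ, hτ⟩ := exists_productState hd h
  obtain ⟨U, hU⟩ := τ.exists_gns_linearIsometryEquiv (q := (mulMap hcomm).toLinearMap) hd
    (denseRange_tensorToGNS φ ψ) fun x => by
      rw [AlgHom.toLinearMap_apply, ← mulMap_star, ← map_mul, hτ, ← inner_tensorToGNS,
        inner_self_eq_norm_sq_to_K]
      rfl
  let conj : (τ.gns.carrier →L[ℂ] τ.gns.carrier) →⋆ₐ[ℂ] GNSTensorOp A B (φ, ψ) :=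
    StarAlgHomClass.toStarAlgHom U.conjStarAlgEquiv
  refine ⟨conj.comp τ.rep, fun a b => ContinuousLinearMap.ext fun z =>
    (denseRange_tensorToGNS φ ψ).induction_on z
      (isClosed_eq (ContinuousLinearMap.continuous _) (ContinuousLinearMap.continuous _))
      fun x => ?_⟩
  calc U (τ.rep (α a * β b) (U.symm (tensorToGNS φ ψ x)))
      = U (τ.rep (mulMap hcomm (a ⊗ₜ b)) (τ.toGNS (mulMap hcomm x))) := by
        rw [← hU, U.symm_apply_apply, mulMap_tmul]
        rfl
    _ = tensorToGNS φ ψ (a ⊗ₜ b * x) := by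
        rw [τ.rep_toGNS, ← map_mul, ← hU]
        rfl
    _ = hmap (φ.rep a) (ψ.rep b) (tensorToGNS φ ψ x) := tensorToGNS_tmul_mul φ ψ a b x

theorem vectorFunctional_htmul {σ : C →⋆ₐ[ℂ] (HilbertTensor H K →L[ℂ] HilbertTensor H K)}
    {π : A →⋆ₐ[ℂ] (H →L[ℂ] H)} {ρ : B →⋆ₐ[ℂ] (K →L[ℂ] K)}
    (hσ : ∀ a b, σ (α a * β b) = hmap (π a) (ρ b)) (η : H) (ζ : K) (x : A ⊗[ℂ] B) :
    vectorFunctional σ (htmul η ζ) (mulMap hcomm x) =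
      TensorProduct.dualDistrib ℂ A B (vectorFunctional π η ⊗ₜ vectorFunctional ρ ζ) x :=
  congr($(TensorProduct.ext'
    (g := vectorFunctional σ (htmul η ζ) ∘ₗ (mulMap hcomm).toLinearMap)
    (h := TensorProduct.dualDistrib ℂ A B (vectorFunctional π η ⊗ₜ vectorFunctional ρ ζ))
    fun a b => by
      rw [LinearMap.comp_apply, AlgHom.toLinearMap_apply, mulMap_tmul, vectorFunctional_apply, hσ,
        hmap_htmul, inner_htmul, TensorProduct.dualDistrib_apply]
      rfl) x)

theorem norm_dualDistrib_state_le_norm_mulMap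
    {σ : C →⋆ₐ[ℂ] (HilbertTensor H K →L[ℂ] HilbertTensor H K)}
    {π : A →⋆ₐ[ℂ] (H →L[ℂ] H)} (hπ : Function.Injective π)
    {ρ : B →⋆ₐ[ℂ] (K →L[ℂ] K)} (hρ : Function.Injective ρ)
    (hσ : ∀ a b, σ (α a * β b) = hmap (π a) (ρ b)) (φ : State A) (ψ : State B) (x : A ⊗[ℂ] B) :
    ‖TensorProduct.dualDistrib ℂ A B (φ.toLinearMap ⊗ₜ ψ.toLinearMap) x‖ ≤ ‖mulMap hcomm x‖ := by
  refine norm_dualDistrib_state_le φ ψ hπ hρ fun η ζ => ?_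
  rw [← vectorFunctional_htmul (hcomm := hcomm) hσ, vectorFunctional_apply, mul_assoc, ← mul_pow,
    ← norm_htmul, sq, ← mul_assoc, mul_comm]
  refine (norm_inner_le_norm _ _).trans (mul_le_mul_of_nonneg_left ?_ (norm_nonneg _))
  exact (σ _).le_of_opNorm_le (NonUnitalStarAlgHom.norm_apply_le σ _) _

open scoped CStarAlgebra in
theorem continuous_vectorFunctional (π : A →⋆ₐ[ℂ] (H →L[ℂ] H)) (η : H) :
    Continuous (vectorFunctional π η) :=
  ((innerSL ℂ η).comp (ContinuousLinearMap.apply ℂ H η)).continuous.comp (map_continuous π)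

theorem vectorFunctional_rep_vacuum {A : Type u} [CStarAlgebra A] (φ : State A) :
    vectorFunctional φ.rep φ.gns.vacuum = φ.toLinearMap :=
  LinearMap.ext fun a => by
    rw [vectorFunctional_apply, ← φ.toGNS_apply, ← φ.toGNS_one, φ.inner_toGNS, star_one, one_mul]

theorem norm_apply_htmul_eq {H' K' : Type*}
    [NormedAddCommGroup H'] [InnerProductSpace ℂ H'] [CompleteSpace H']
    [NormedAddCommGroup K'] [InnerProductSpace ℂ K'] [CompleteSpace K']
    (hd : DenseRange (mulMap hcomm))
    {σ : C →⋆ₐ[ℂ] (HilbertTensor H K →L[ℂ] HilbertTensor H K)}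
    {π : A →⋆ₐ[ℂ] (H →L[ℂ] H)} {ρ : B →⋆ₐ[ℂ] (K →L[ℂ] K)}
    (hσ : ∀ a b, σ (α a * β b) = hmap (π a) (ρ b))
    {σ' : C →⋆ₐ[ℂ] (HilbertTensor H' K' →L[ℂ] HilbertTensor H' K')}
    {π' : A →⋆ₐ[ℂ] (H' →L[ℂ] H')} {ρ' : B →⋆ₐ[ℂ] (K' →L[ℂ] K')}
    (hσ' : ∀ a b, σ' (α a * β b) = hmap (π' a) (ρ' b))
    {η : H} {η' : H'} (hη : vectorFunctional π η = vectorFunctional π' η')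
    {ζ : K} {ζ' : K'} (hζ : vectorFunctional ρ ζ = vectorFunctional ρ' ζ') (c : C) :
    ‖σ c (htmul η ζ)‖ = ‖σ' c (htmul η' ζ')‖ := by
  have h_functional (c : C) :
      vectorFunctional σ (htmul η ζ) c = vectorFunctional σ' (htmul η' ζ') c :=
    hd.induction_on c (isClosed_eq (continuous_vectorFunctional _ _)
      (continuous_vectorFunctional _ _)) fun x => by
        rw [vectorFunctional_htmul hσ, vectorFunctional_htmul hσ', hη, hζ]
  have h_sq := h_functional (star c * c)
  rw [vectorFunctional_star_mul_self, vectorFunctional_star_mul_self] at h_sq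
  exact (sq_eq_sq₀ (norm_nonneg _) (norm_nonneg _)).mp (Complex.ofReal_injective h_sq)

/-- A uniformly bounded family of *-homomorphisms as a *-homomorphism to the bounded families. -/
def lpStarAlgHom {ι C : Type*} {D : ι → Type*} [NormedRing C] [StarRing C]
    [Algebra ℂ C] [∀ i, NormedRing (D i)] [∀ i, NormedAlgebra ℂ (D i)] [∀ i, StarRing (D i)]
    [∀ i, NormedStarGroup (D i)] [∀ i, StarModule ℂ (D i)] [∀ i, NormOneClass (D i)]
    (Φ : ∀ i, C →⋆ₐ[ℂ] D i) (h : ∀ i c, ‖Φ i c‖ ≤ ‖c‖) : C →⋆ₐ[ℂ] lp D ∞ where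
  toFun c := ⟨fun i => Φ i c, memℓp_infty ⟨‖c‖, Set.forall_mem_range.mpr (h · c)⟩⟩
  map_one' := lp.ext (funext fun i => map_one (Φ i))
  map_mul' x y := lp.ext (funext fun i => map_mul (Φ i) x y)
  map_zero' := lp.ext (funext fun i => map_zero (Φ i))
  map_add' x y := lp.ext (funext fun i => map_add (Φ i) x y)
  commutes' r := lp.ext (funext fun i => AlgHomClass.commutes (Φ i) r)
  map_star' x := lp.ext (funext fun i => map_star (Φ i) x)

theorem exists_starAlgEquiv_topologicalClosure_adjoin {D : Type*} [NormedRing D] [StarRing D]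
    [NormedAlgebra ℂ D] [ContinuousStar D] [StarModule ℂ D] {Ψ : C →⋆ₐ[ℂ] D} (hΨ : Isometry Ψ)
    {s : Set C} (hs : (StarAlgebra.adjoin ℂ s).topologicalClosure = ⊤) {t : Set D}
    (ht : Ψ '' s = t) :
    ∃ e : C ≃⋆ₐ[ℂ] (StarAlgebra.adjoin ℂ t).topologicalClosure, ∀ c, (e c : D) = Ψ c := by
  have range_eq : Ψ.range = (StarAlgebra.adjoin ℂ t).topologicalClosure := by
    rw [StarAlgHom.range_eq_map_top, ← hs, ← ht, ← StarAlgHom.map_adjoin,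
      StarSubalgebra.topologicalClosure_map _ _ hΨ.isClosedEmbedding.isClosedMap hΨ.continuous]
  exact range_eq ▸ ⟨StarAlgEquiv.ofInjective Ψ hΨ.injective, fun _ => rfl⟩

theorem topologicalClosure_adjoin_mul (hd : DenseRange (mulMap hcomm)) :
    (StarAlgebra.adjoin ℂ {c | ∃ a b, α a * β b = c}).topologicalClosure = ⊤ := by
  refine top_le_iff.mp fun c _ => hd.induction_on (p := (· ∈ StarSubalgebra.topologicalClosure _)) c
    (StarSubalgebra.isClosed_topologicalClosure _) fun x =>
      StarSubalgebra.le_topologicalClosure _ ?_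
  induction x using TensorProduct.induction_on with
  | zero => rw [map_zero]; exact zero_mem _
  | add x y hx hy => rw [map_add]; exact add_mem hx hy
  | tmul a b => exact mulMap_tmul hcomm a b ▸ StarAlgebra.subset_adjoin ℂ _ ⟨a, b, rfl⟩

theorem isometry_lpStarAlgHom {ι : Type*} {D : ι → Type*} [∀ i, CStarAlgebra (D i)]
    [∀ i, NormOneClass (D i)]
    {Φ : ∀ i, C →⋆ₐ[ℂ] D i} (h : ∀ i c, ‖Φ i c‖ ≤ ‖c‖) (h_zero : ∀ c, (∀ i, Φ i c = 0) → c = 0) :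
    Isometry (lpStarAlgHom Φ h) :=
  NonUnitalStarAlgHom.isometry (lpStarAlgHom Φ h) <| (injective_iff_map_eq_zero _).mpr fun c hc =>
    h_zero c fun i => congr(($hc : ∀ i, D i) i)

theorem exists_starAlgEquiv_minTensor_of_separating (hd : DenseRange (mulMap hcomm))
    {Φ : ∀ p : State A × State B, C →⋆ₐ[ℂ] GNSTensorOp A B p}
    (hΦ : ∀ p a b, Φ p (α a * β b) = hmap (p.1.rep a) (p.2.rep b))
    (h_zero : ∀ c, (∀ p, Φ p c = 0) → c = 0) :
    ∃ e : C ≃⋆ₐ[ℂ] MinTensor A B, ∀ a b, e (α a * β b) = MinTensor.tmul a b := by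
  have norm_le (p : State A × State B) := NonUnitalStarAlgHom.norm_apply_le (Φ p)
  have map_mul_eq (a : A) (b : B) : lpStarAlgHom Φ norm_le (α a * β b) = tensorFamily a b :=
    lp.ext (funext fun p => hΦ p a b)
  have image_eq : lpStarAlgHom Φ norm_le '' {c | ∃ a b, α a * β b = c} =
      {x | ∃ a b, x = tensorFamily a b} := by
    ext x
    constructor
    · rintro ⟨_, ⟨a, b, rfl⟩, rfl⟩
      exact ⟨a, b, map_mul_eq a b⟩
    · rintro ⟨a, b, rfl⟩
      exact ⟨α a * β b, ⟨a, b, rfl⟩, map_mul_eq a b⟩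
  exact (exists_starAlgEquiv_topologicalClosure_adjoin
    (isometry_lpStarAlgHom norm_le h_zero) (topologicalClosure_adjoin_mul hd) image_eq).imp
    fun e he a b => Subtype.ext ((he _).trans (map_mul_eq a b))

/-- The spatial norm does not depend on the faithful representations it is computed in: faithful
`π` and `ρ` bound every product of states, whose GNS representations therefore factor through `C`,
and the vector states of `π` and `ρ` already detect every element of `C`. -/
theorem exists_starAlgEquiv_minTensor (hd : DenseRange (mulMap hcomm))
    {σ : C →⋆ₐ[ℂ] (HilbertTensor H K →L[ℂ] HilbertTensor H K)} (hσ_inj : Function.Injective σ)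
    {π : A →⋆ₐ[ℂ] (H →L[ℂ] H)} (hπ : Function.Injective π)
    {ρ : B →⋆ₐ[ℂ] (K →L[ℂ] K)} (hρ : Function.Injective ρ)
    (hσ : ∀ a b, σ (α a * β b) = hmap (π a) (ρ b)) :
    ∃ e : C ≃⋆ₐ[ℂ] MinTensor A B, ∀ a b, e (α a * β b) = MinTensor.tmul a b := by
  choose Φ hΦ using fun p : State A × State B => exists_tensorRep (φ := p.1) (ψ := p.2) hd
    (norm_dualDistrib_state_le_norm_mulMap hπ hρ hσ p.1 p.2)
  refine exists_starAlgEquiv_minTensor_of_separating hd hΦ fun c hc =>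
    (injective_iff_map_eq_zero σ).mp hσ_inj c <| eq_zero_of_forall_norm_eq_one fun η ζ hη hζ => ?_
  rw [← norm_eq_zero, norm_apply_htmul_eq hd hσ (hΦ (vectorState π hη, vectorState ρ hζ))
    (vectorFunctional_rep_vacuum (vectorState π hη)).symm
    (vectorFunctional_rep_vacuum (vectorState ρ hζ)).symm, hc, zero_apply, norm_zero]

theorem map_mul_eq_hmap {σ : C →⋆ₐ[ℂ] (HilbertTensor H K →L[ℂ] HilbertTensor H K)}
    {π : A →⋆ₐ[ℂ] (H →L[ℂ] H)} {ρ : B →⋆ₐ[ℂ] (K →L[ℂ] K)}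
    (hα : ∀ a, σ (α a) = hmap (π a) (.id ℂ K)) (hβ : ∀ b, σ (β b) = hmap (.id ℂ H) (ρ b))
    (a : A) (b : B) : σ (α a * β b) = hmap (π a) (ρ b) := by
  rw [map_mul, hα, hβ, ContinuousLinearMap.mul_def, hmap_comp_hmap, ContinuousLinearMap.comp_id,
    ContinuousLinearMap.id_comp]

theorem commute_of_map_eq_hmap {σ : C →⋆ₐ[ℂ] (HilbertTensor H K →L[ℂ] HilbertTensor H K)}
    (hσ_inj : Function.Injective σ) {π : A →⋆ₐ[ℂ] (H →L[ℂ] H)} {ρ : B →⋆ₐ[ℂ] (K →L[ℂ] K)}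
    (hα : ∀ a, σ (α a) = hmap (π a) (.id ℂ K)) (hβ : ∀ b, σ (β b) = hmap (.id ℂ H) (ρ b))
    (a : A) (b : B) : Commute (α a) (β b) :=
  hσ_inj <| by
    rw [map_mul_eq_hmap hα hβ, map_mul, hα, hβ, ContinuousLinearMap.mul_def, hmap_comp_hmap,
      ContinuousLinearMap.id_comp, ContinuousLinearMap.comp_id]

end SpatialTensor

section Single

variable {α β : Type*} {K : β → Type*} [∀ b, NormedAddCommGroup (K b)]
  [∀ b, InnerProductSpace ℂ (K b)]

open Classical in
/-- The isometric inclusion of a summand in a Hilbert sum. -/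
def singleLp (b : β) : K b →ₗᵢ[ℂ] lp K 2 where
  toFun k := lp.single 2 b k
  map_add' := lp.single_add 2 b
  map_smul' := lp.single_smul 2 b
  norm_map' := lp.norm_single two_pos b

open Classical in
theorem singleLp_apply_self (b : β) (k : K b) : singleLp b k b = k :=
  lp.single_apply_self 2 b k

open Classical in
theorem singleLp_apply_ne {b b' : β} (k : K b) (h : b' ≠ b) : singleLp b k b' = 0 :=
  lp.single_apply_ne 2 b k h

theorem pushLp_singleLp (e : α ↪ β) (a : α) (k : K (e a)) :
    pushLp e (singleLp (K := fun a => K (e a)) a k) = singleLp (e a) k := by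
  refine lp.ext (funext fun b => ?_)
  rw [pushLp_apply]
  by_cases hb : b ∈ Set.range e
  · obtain ⟨a', rfl⟩ := hb
    rw [push_apply]
    obtain rfl | h := eq_or_ne a' a
    · rw [singleLp_apply_self, singleLp_apply_self]
    · rw [singleLp_apply_ne (K := fun a => K (e a)) k h, singleLp_apply_ne k (e.injective.ne h)]
  · rw [push_of_notMem e _ hb, singleLp_apply_ne k fun h => hb ⟨a, h.symm⟩]

theorem mapLp_singleLp {E : Type*} [NormedAddCommGroup E] [InnerProductSpace ℂ E]
    {G G' : α → Type*} [∀ a, NormedAddCommGroup (G a)] [∀ a, InnerProductSpace ℂ (G a)]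
    [∀ a, NormedAddCommGroup (G' a)] [∀ a, InnerProductSpace ℂ (G' a)]
    (c : ∀ a, E →ₗ[ℂ] G a →ₗ[ℂ] G' a)
    (hc : ∀ a x x' y y', ⟪c a x y, c a x' y'⟫_ℂ = ⟪x, x'⟫_ℂ * ⟪y, y'⟫_ℂ)
    (h : E) (a : α) (k : G a) : mapLp c hc h (singleLp a k) = singleLp a (c a h k) := by
  refine lp.ext (funext fun b => ?_)
  change c b h (singleLp a k b) = _
  obtain rfl | hb := eq_or_ne b a
  · rw [singleLp_apply_self, singleLp_apply_self]
  · rw [singleLp_apply_ne k hb, singleLp_apply_ne _ hb, map_zero]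

theorem concat_singleLp (Q : PointedHilbert.{u}) (e₀ e₁ : α ↪ β)
    (c : ∀ a, Q.reduced →ₗ[ℂ] K (e₀ a) →ₗ[ℂ] K (e₁ a))
    (hc : ∀ a x x' y y', ⟪c a x y, c a x' y'⟫_ℂ = ⟪x, x'⟫_ℂ * ⟪y, y'⟫_ℂ) (h : Q.carrier) (a : α)
    (k : K (e₀ a)) :
    concat Q e₀ e₁ c hc h (singleLp (K := fun a => K (e₀ a)) a k) =
      ⟪Q.vacuum, h⟫_ℂ • singleLp (e₀ a) k + singleLp (e₁ a) (c a (Q.proj h) k) := by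
  rw [concat_apply, pushLp_singleLp, mapLp_singleLp (G := fun a => K (e₀ a)), pushLp_singleLp]

end Single

section PointedHilbert

variable (Q : PointedHilbert.{u})

theorem PointedHilbert.inner_vacuum_self : ⟪Q.vacuum, Q.vacuum⟫_ℂ = 1 := by
  rw [inner_self_eq_norm_sq_to_K, Q.norm_vacuum]
  simp

theorem PointedHilbert.inner_vacuum_reduced (k : Q.reduced) : ⟪Q.vacuum, k.1⟫_ℂ = 0 :=
  Submodule.mem_orthogonal_singleton_iff_inner_right.mp k.2

theorem PointedHilbert.proj_vacuum : Q.proj Q.vacuum = 0 :=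
  ext_inner_right ℂ fun k =>
    ((Q.reduced.inner_orthogonalProjectionOnto_eq_of_mem_right k Q.vacuum).trans
      (Q.inner_vacuum_reduced k)).trans (inner_zero_left k).symm

theorem PointedHilbert.proj_reduced (k : Q.reduced) : Q.proj k.1 = k :=
  Submodule.orthogonalProjectionOnto_mem_subspace_eq_self k

end PointedHilbert

section FreeProductVectors

variable {I : Type v} (P : I → PointedHilbert.{u}) {i : I}

theorem leftRep_leftConcat (T : (P i).carrier →L[ℂ] (P i).carrier) (h : (P i).carrier)
    (x : FreeProductL P i) : leftRep P i T (leftConcat P i h x) = leftConcat P i (T h) x := by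
  have leftUnitary_htmul (h : (P i).carrier) : leftUnitary P i (htmul h x) = leftConcat P i h x :=
    hlift_htmul _ (inner_leftConcat P i) h x
  rw [← leftUnitary_htmul, ← leftUnitary_htmul, leftRep, ContinuousLinearMap.comp_apply,
    ContinuousLinearMap.comp_apply, adjoint_linearIsometry_apply, hmap_htmul]
  rfl

theorem rightRep_rightConcat (T : (P i).carrier →L[ℂ] (P i).carrier) (h : (P i).carrier)
    (x : FreeProductR P i) : rightRep P i T (rightConcat P i h x) = rightConcat P i (T h) x := by
  have rightUnitary_htmul (h : (P i).carrier) :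
      rightUnitary P i (htmul x h) = rightConcat P i h x :=
    hlift_htmul (rightConcat P i).flip _ x h
  rw [← rightUnitary_htmul, ← rightUnitary_htmul, rightRep, ContinuousLinearMap.comp_apply,
    ContinuousLinearMap.comp_apply, adjoint_linearIsometry_apply, hmap_htmul]
  rfl

theorem adjoint_leftRep (T : (P i).carrier →L[ℂ] (P i).carrier) :
    (leftRep P i T).adjoint = leftRep P i T.adjoint := by
  simp only [leftRep, ContinuousLinearMap.adjoint_comp, ContinuousLinearMap.adjoint_adjoint,
    adjoint_hmap, ContinuousLinearMap.adjoint_id, ContinuousLinearMap.comp_assoc]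

theorem adjoint_rightRep (T : (P i).carrier →L[ℂ] (P i).carrier) :
    (rightRep P i T).adjoint = rightRep P i T.adjoint := by
  simp only [rightRep, ContinuousLinearMap.adjoint_comp, ContinuousLinearMap.adjoint_adjoint,
    adjoint_hmap, ContinuousLinearMap.adjoint_id, ContinuousLinearMap.comp_assoc]

/-- The inclusion of the summand of an alternating word in the free product. -/
def word {w : List I} (hw : w.IsChain (· ≠ ·)) : WordSpace P w →ₗᵢ[ℂ] FreeProduct P :=
  singleLp (K := fun w : AltWord I => WordSpace P w.1) ⟨w, hw⟩

/-- The inclusion in `H(l, i)` of the summand of a word `w`, which has to be such that `iw` is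
alternating. -/
def wordL {w : List I} (hw : (i :: w).IsChain (· ≠ ·)) :
    WordSpace P w →ₗᵢ[ℂ] FreeProductL P i :=
  singleLp (K := fun w : AltWordL i => WordSpace P w.1.1) ⟨⟨w, hw.of_cons⟩, fun h =>
    (List.isChain_cons.mp hw).1 i h rfl⟩

/-- The inclusion in `H(r, i)` of the summand of a word `w`, which has to be such that `wi` is
alternating. -/
def wordR {w : List I} (hw : (w ++ [i]).IsChain (· ≠ ·)) :
    WordSpace P w →ₗᵢ[ℂ] FreeProductR P i :=
  singleLp (K := fun w : AltWordR i => WordSpace P w.1.1) ⟨⟨w, hw.left_of_append⟩, fun h =>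
    (List.isChain_append.mp hw).2.2 i h i rfl rfl⟩

theorem leftConcat_wordL {w : List I} (hw : (i :: w).IsChain (· ≠ ·)) (h : (P i).carrier)
    (t : WordSpace P w) : leftConcat P i h (wordL P hw t) =
      ⟪(P i).vacuum, h⟫_ℂ • word P hw.of_cons t +
        word P hw (consTensor P i w ((P i).proj h) t) :=
  concat_singleLp (K := fun w : AltWord I => WordSpace P w.1) (P i) (Function.Embedding.subtype _)
    (consWord i) (fun w => consTensor P i w.1.1) (fun w => inner_consTensor P i w.1.1) h
    ⟨⟨w, hw.of_cons⟩, _⟩ t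

theorem rightConcat_wordR {w : List I} (hw : (w ++ [i]).IsChain (· ≠ ·)) (h : (P i).carrier)
    (t : WordSpace P w) : rightConcat P i h (wordR P hw t) =
      ⟪(P i).vacuum, h⟫_ℂ • word P hw.left_of_append t +
        word P hw (snocTensor P i w ((P i).proj h) t) :=
  concat_singleLp (K := fun w : AltWord I => WordSpace P w.1) (P i) (Function.Embedding.subtype _)
    (snocWord i) (fun w => ContinuousLinearMap.coeLM ℂ ∘ₗ snocTensor P i w.1.1)
    (fun w => inner_snocTensor P i w.1.1) h ⟨⟨w, hw.left_of_append⟩, _⟩ t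

/-- The inclusion of `H(l, i)` in the free product. -/
def inclL (i : I) : FreeProductL P i →ₗ[ℂ] FreeProduct P :=
  pushLp (K := fun w : AltWord I => WordSpace P w.1) (Function.Embedding.subtype _)

theorem inner_inclL (x y : FreeProductL P i) : ⟪inclL P i x, inclL P i y⟫_ℂ = ⟪x, y⟫_ℂ :=
  inner_pushLp (K := fun w : AltWord I => WordSpace P w.1) (Function.Embedding.subtype _) x y

theorem inclL_wordL {w : List I} (hw : (i :: w).IsChain (· ≠ ·)) (t : WordSpace P w) :
    inclL P i (wordL P hw t) = word P hw.of_cons t :=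
  pushLp_singleLp (K := fun w : AltWord I => WordSpace P w.1) (Function.Embedding.subtype _)
    ⟨⟨w, hw.of_cons⟩, _⟩ t

/-- The unit vector spanning the space of the empty word. -/
def emptyVec : WordSpace P ([] : List I) :=
  (EuclideanSpace.single PUnit.unit (1 : ℂ) : EuclideanSpace ℂ PUnit.{u + 1})

theorem norm_emptyVec : ‖emptyVec P‖ = 1 :=
  (PiLp.norm_single 2 (fun _ => ℂ) PUnit.unit 1).trans norm_one

theorem inner_emptyVec : ⟪emptyVec P, emptyVec P⟫_ℂ = 1 :=
  inner_self_eq_one_of_norm_eq_one (norm_emptyVec P)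

theorem norm_consTensor (w : List I) (k : (P i).reduced) (t : WordSpace P w) :
    ‖consTensor P i w k t‖ = ‖k‖ * ‖t‖ :=
  norm_htmul k t

theorem word_nil_emptyVec : word P List.isChain_nil (emptyVec P) = freeVacuum P :=
  congrArg (fun _ : DecidableEq (AltWord I) => lp.single (E := fun w : AltWord I => WordSpace P w.1)
    2 ⟨[], List.isChain_nil⟩ (emptyVec P)) (Subsingleton.elim _ _)

/-- The inclusion of `H_i` in the free product. -/
def incl (i : I) : (P i).carrier →ₗᵢ[ℂ] FreeProduct P :=
  ((leftConcat P i).flip (wordL P (List.isChain_singleton i) (emptyVec P))).isometryOfInner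
    fun h h' => by
      rw [LinearMap.flip_apply, LinearMap.flip_apply, inner_leftConcat,
        LinearIsometry.inner_map_map, inner_emptyVec, mul_one]

theorem incl_apply (h : (P i).carrier) : incl P i h = ⟪(P i).vacuum, h⟫_ℂ • freeVacuum P +
    word P (List.isChain_singleton i) (consTensor P i [] ((P i).proj h) (emptyVec P)) :=
  (leftConcat_wordL P (List.isChain_singleton i) h (emptyVec P)).trans
    (by rw [← word_nil_emptyVec])

theorem incl_eq_rightConcat (h : (P i).carrier) : incl P i h =
    rightConcat P i h (wordR P (w := []) (List.isChain_singleton i) (emptyVec P)) := by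
  rw [incl_apply, ← word_nil_emptyVec]
  exact (rightConcat_wordR P (w := []) (List.isChain_singleton i) h (emptyVec P)).symm

theorem incl_vacuum : incl P i (P i).vacuum = freeVacuum P := by
  rw [incl_apply, PointedHilbert.inner_vacuum_self, PointedHilbert.proj_vacuum, map_zero,
    LinearMap.zero_apply, map_zero, one_smul, add_zero]

theorem incl_reduced (k : (P i).reduced) :
    incl P i k = word P (List.isChain_singleton i) (consTensor P i [] k (emptyVec P)) := by
  rw [incl_apply, PointedHilbert.inner_vacuum_reduced, PointedHilbert.proj_reduced, zero_smul,
    zero_add]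

theorem leftRep_comp_incl (T : (P i).carrier →L[ℂ] (P i).carrier) :
    leftRep P i T ∘L (incl P i).toContinuousLinearMap =
      (incl P i).toContinuousLinearMap ∘L T :=
  ContinuousLinearMap.ext fun h => leftRep_leftConcat P T h _

theorem rightRep_comp_incl (T : (P i).carrier →L[ℂ] (P i).carrier) :
    rightRep P i T ∘L (incl P i).toContinuousLinearMap =
      (incl P i).toContinuousLinearMap ∘L T :=
  ContinuousLinearMap.ext fun h => by
    simp only [ContinuousLinearMap.comp_apply, LinearIsometry.coe_toContinuousLinearMap,
      incl_eq_rightConcat, rightRep_rightConcat]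

/-- The map `ζ ↦ t ⊗ ζ` from `H_i` to `H(l, i)`, where `t` belongs to the summand of a word `w`
such that `iwi` is alternating, and the distinguished vector of `H_i` is absorbed. -/
def tensorRight {w : List I} (hw : (i :: (w ++ [i])).IsChain (· ≠ ·)) (t : WordSpace P w) :
    (P i).carrier →ₗ[ℂ] FreeProductL P i :=
  ((innerSL ℂ (P i).vacuum).toLinearMap.smulRight
      (wordL P (List.IsChain.left_of_append (l₁ := i :: w) hw) t)) +
    (wordL P hw).toLinearMap ∘ₗ
      (ContinuousLinearMap.coeLM ℂ ∘ₗ snocTensor P i w).flip t ∘ₗ (P i).proj.toLinearMap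

variable {w : List I} (hw : (i :: (w ++ [i])).IsChain (· ≠ ·)) (t : WordSpace P w)

theorem tensorRight_apply (ζ : (P i).carrier) : tensorRight P hw t ζ =
    ⟪(P i).vacuum, ζ⟫_ℂ • wordL P (List.IsChain.left_of_append (l₁ := i :: w) hw) t +
      wordL P hw (snocTensor P i w ((P i).proj ζ) t) := rfl

theorem inner_tensorRight (t' : WordSpace P w) (ζ ζ' : (P i).carrier) :
    ⟪tensorRight P hw t ζ, tensorRight P hw t' ζ'⟫_ℂ = ⟪ζ, ζ'⟫_ℂ * ⟪t, t'⟫_ℂ := by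
  have inclL_tensorRight (t : WordSpace P w) (ζ : (P i).carrier) :
      inclL P i (tensorRight P hw t ζ) = rightConcat P i ζ (wordR P hw.of_cons t) := by
    rw [tensorRight_apply, rightConcat_wordR, map_add, map_smul, inclL_wordL, inclL_wordL]
  rw [← inner_inclL, inclL_tensorRight, inclL_tensorRight, inner_rightConcat,
    LinearIsometry.inner_map_map]

/-- The isometry `η ⊗ ζ ↦ η ⊗ t ⊗ ζ` from `H_i ⊗ H_i` to the free product, where `t` is a unit
vector of the summand of a word `w` such that `iwi` is alternating, and the distinguished vector
of `H_i` is absorbed on both sides. -/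
def sandwich {t : WordSpace P w} (ht : ‖t‖ = 1) :
    HilbertTensor (P i).carrier (P i).carrier →ₗᵢ[ℂ] FreeProduct P :=
  hlift ((leftConcat P i).compl₂ (tensorRight P hw t)) fun η η' ζ ζ' => by
    rw [LinearMap.compl₂_apply, LinearMap.compl₂_apply, inner_leftConcat, inner_tensorRight,
      inner_self_eq_one_of_norm_eq_one ht, mul_one]

variable {t} (ht : ‖t‖ = 1)

theorem sandwich_htmul (η ζ : (P i).carrier) :
    sandwich P hw ht (htmul η ζ) = leftConcat P i η (tensorRight P hw t ζ) :=
  hlift_htmul _ _ η ζ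

theorem snocTensor_consTensor (k k' : (P i).reduced) (t : WordSpace P w) :
    snocTensor P i (i :: w) k' (consTensor P i w k t) =
      consTensor P i (w ++ [i]) k (snocTensor P i w k' t) :=
  hmap_htmul _ _ _ _

theorem sandwich_htmul_eq_rightConcat (η ζ : (P i).carrier) :
    sandwich P hw ht (htmul η ζ) = rightConcat P i ζ
      (⟪(P i).vacuum, η⟫_ℂ • wordR P hw.of_cons t +
        wordR P (w := i :: w) hw (consTensor P i w ((P i).proj η) t)) := by
  rw [sandwich_htmul, tensorRight_apply, map_add, map_smul, map_add, map_smul, leftConcat_wordL,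
    leftConcat_wordL, rightConcat_wordR, rightConcat_wordR (w := i :: w), snocTensor_consTensor]
  simp only [smul_add, smul_smul, mul_comm ⟪(P i).vacuum, η⟫_ℂ]
  exact add_add_add_comm _ _ _ _

theorem leftRep_comp_sandwich (T : (P i).carrier →L[ℂ] (P i).carrier) :
    leftRep P i T ∘L (sandwich P hw ht).toContinuousLinearMap =
      (sandwich P hw ht).toContinuousLinearMap ∘L hmap T (.id ℂ _) :=
  ext_htmul fun η ζ => by
    simp only [ContinuousLinearMap.comp_apply, LinearIsometry.coe_toContinuousLinearMap,
      hmap_htmul, sandwich_htmul, leftRep_leftConcat, ContinuousLinearMap.id_apply]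

theorem rightRep_comp_sandwich (T : (P i).carrier →L[ℂ] (P i).carrier) :
    rightRep P i T ∘L (sandwich P hw ht).toContinuousLinearMap =
      (sandwich P hw ht).toContinuousLinearMap ∘L hmap (.id ℂ _) T :=
  ext_htmul fun η ζ => by
    simp only [ContinuousLinearMap.comp_apply, LinearIsometry.coe_toContinuousLinearMap,
      hmap_htmul, sandwich_htmul_eq_rightConcat, rightRep_rightConcat, ContinuousLinearMap.id_apply]

theorem sandwich_vacuum : sandwich P hw ht (htmul (P i).vacuum (P i).vacuum) =
    word P (List.IsChain.left_of_append (l₁ := i :: w) hw).of_cons t := by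
  rw [sandwich_htmul, tensorRight_apply, PointedHilbert.inner_vacuum_self,
    PointedHilbert.proj_vacuum, map_zero, one_smul, zero_apply, map_zero, add_zero,
    leftConcat_wordL, PointedHilbert.inner_vacuum_self, PointedHilbert.proj_vacuum, map_zero,
    one_smul, LinearMap.zero_apply, map_zero, add_zero]

/-- The isometry is `η ⊗ ζ ↦ η ⊗ k ⊗ ζ`, with the distinguished vectors absorbed. -/
theorem exists_linearIsometry_intertwining {j : I} (hij : i ≠ j) {k : (P j).reduced}
    (hk : ‖k‖ = 1) :
    ∃ J : HilbertTensor (P i).carrier (P i).carrier →ₗᵢ[ℂ] FreeProduct P,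
      J (htmul (P i).vacuum (P i).vacuum) = incl P j k ∧
      (∀ T, leftRep P i T ∘L J.toContinuousLinearMap =
        J.toContinuousLinearMap ∘L hmap T (.id ℂ _)) ∧
      ∀ T, rightRep P i T ∘L J.toContinuousLinearMap =
        J.toContinuousLinearMap ∘L hmap (.id ℂ _) T := by
  have hw : (i :: ([j] ++ [i])).IsChain (· ≠ ·) :=
    .cons_cons hij (.cons_cons hij.symm (.singleton i))
  have ht : ‖consTensor P j [] k (emptyVec P)‖ = 1 := by
    rw [norm_consTensor, hk, norm_emptyVec, one_mul]
  exact ⟨sandwich P hw ht, (sandwich_vacuum P hw ht).trans (incl_reduced P k).symm,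
    leftRep_comp_sandwich P hw ht, rightRep_comp_sandwich P hw ht⟩

end FreeProductVectors

section Faces

variable {A : Type u} [CStarAlgebra A]

theorem PairOfFaces.inl_injective (F : PairOfFaces A) : Function.Injective F.inl :=
  fun _ _ h => Subtype.ext congr(($h : A))

theorem PairOfFaces.inr_injective (F : PairOfFaces A) : Function.Injective F.inr :=
  fun _ _ h => Subtype.ext congr(($h : A))

theorem PairOfFaces.topologicalClosure_adjoin (F : PairOfFaces A) :
    (StarAlgebra.adjoin ℂ (Set.range F.inl ∪ Set.range F.inr)).topologicalClosure = ⊤ := by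
  set S := StarAlgebra.adjoin ℂ (Set.range F.inl ∪ Set.range F.inr)
  have sup_le_map : F.left ⊔ F.right ≤ S.map F.generated.subtype := by
    refine sup_le (fun a ha => ⟨F.inl ⟨a, ha⟩, ?_, rfl⟩) fun b hb => ⟨F.inr ⟨b, hb⟩, ?_, rfl⟩
    · exact StarAlgebra.subset_adjoin ℂ _ (Or.inl ⟨_, rfl⟩)
    · exact StarAlgebra.subset_adjoin ℂ _ (Or.inr ⟨_, rfl⟩)
  refine top_unique fun x _ => closure_subtype.mpr ?_
  exact closure_mono (t := (↑) '' (S : Set F.generated)) sup_le_map x.2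

theorem PairOfFaces.denseRange_mulMap (F : PairOfFaces A)
    (hcomm : ∀ a b, Commute (F.inl a) (F.inr b)) : DenseRange (mulMap hcomm) := by
  let S : StarSubalgebra ℂ F.generated :=
    { (mulMap hcomm).range with
      star_mem' := by
        rintro _ ⟨x, rfl⟩
        exact ⟨star x, mulMap_star hcomm x⟩ }
  have adjoin_le : StarAlgebra.adjoin ℂ (Set.range F.inl ∪ Set.range F.inr) ≤ S := by
    refine StarAlgebra.adjoin_le ?_
    rintro _ (⟨a, rfl⟩ | ⟨b, rfl⟩)
    · exact ⟨a ⊗ₜ 1, (mulMap_tmul hcomm a 1).trans (by rw [map_one, mul_one])⟩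
    · exact ⟨1 ⊗ₜ b, (mulMap_tmul hcomm 1 b).trans (by rw [map_one, one_mul])⟩
  exact fun x => closure_mono adjoin_le
    (F.topologicalClosure_adjoin.ge (StarSubalgebra.mem_top (x := x)))

variable {I : Type v} {φ : State A} {F : I → PairOfFaces A}

theorem isClosed_biFreeProduct :
    IsClosed (biFreeProduct φ F :
      Set (FreeProduct (faceHilbert φ F) →L[ℂ] FreeProduct (faceHilbert φ F))) :=
  StarSubalgebra.isClosed_topologicalClosure _

theorem leftRep_mem_biFreeProduct (i : I) (a : (F i).left) :
    leftRep _ i (faceRep φ F i ((F i).inl a)) ∈ biFreeProduct φ F :=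
  StarSubalgebra.le_topologicalClosure _ (StarAlgebra.subset_adjoin ℂ _ (Or.inl ⟨i, a, rfl⟩))

theorem rightRep_mem_biFreeProduct (i : I) (b : (F i).right) :
    rightRep _ i (faceRep φ F i ((F i).inr b)) ∈ biFreeProduct φ F :=
  StarSubalgebra.le_topologicalClosure _ (StarAlgebra.subset_adjoin ℂ _ (Or.inr ⟨i, b, rfl⟩))

theorem eq_zero_of_apply_freeVacuum (hfaithful : (biFreeState φ F).IsFaithful)
    {T : FreeProduct (faceHilbert φ F) →L[ℂ] FreeProduct (faceHilbert φ F)}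
    (hT : T ∈ biFreeProduct φ F) (h : T (freeVacuum (faceHilbert φ F)) = 0) : T = 0 := by
  refine congrArg Subtype.val (hfaithful ⟨T, hT⟩ ?_)
  change ⟪freeVacuum (faceHilbert φ F), T.adjoint (T (freeVacuum (faceHilbert φ F)))⟫_ℂ = 0
  rw [h, map_zero, inner_zero_right]

theorem eq_of_comp_incl_eq (hfaithful : (biFreeState φ F).IsFaithful) {i : I}
    {S T : FreeProduct (faceHilbert φ F) →L[ℂ] FreeProduct (faceHilbert φ F)}
    (hS : S ∈ biFreeProduct φ F) (hT : T ∈ biFreeProduct φ F)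
    (h : S ∘L (incl (faceHilbert φ F) i).toContinuousLinearMap =
      T ∘L (incl (faceHilbert φ F) i).toContinuousLinearMap) : S = T := by
  refine sub_eq_zero.mp (eq_zero_of_apply_freeVacuum hfaithful (sub_mem hS hT) ?_)
  rw [← incl_vacuum (i := i)]
  exact sub_eq_zero.mpr congr($h (faceHilbert φ F i).vacuum)

theorem exists_faceDilation (hfaithful : (biFreeState φ F).IsFaithful) (i : I) :
    ∃ θ : (F i).generated →⋆ₐ[ℂ] biFreeProduct φ F,
      (∀ c, (θ c).1 ∘L (incl (faceHilbert φ F) i).toContinuousLinearMap =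
        (incl (faceHilbert φ F) i).toContinuousLinearMap ∘L faceRep φ F i c) ∧
      (∀ a, (θ ((F i).inl a)).1 = leftRep _ i (faceRep φ F i ((F i).inl a))) ∧
      ∀ b, (θ ((F i).inr b)).1 = rightRep _ i (faceRep φ F i ((F i).inr b)) := by
  have eq_zero : ∀ T ∈ biFreeProduct φ F,
      T (incl (faceHilbert φ F) i (faceHilbert φ F i).vacuum) = 0 → T = 0 := fun T hT h =>
    eq_zero_of_apply_freeVacuum hfaithful hT (by rwa [incl_vacuum] at h)
  obtain ⟨θ, hθ⟩ := exists_dilation isClosed_biFreeProduct eq_zero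
    (F i).topologicalClosure_adjoin (π := faceRep φ F i) (by
      rintro _ (⟨a, rfl⟩ | ⟨b, rfl⟩)
      · exact ⟨_, leftRep_mem_biFreeProduct i a, leftRep_comp_incl _ _,
          by rw [adjoint_leftRep, leftRep_comp_incl]⟩
      · exact ⟨_, rightRep_mem_biFreeProduct i b, rightRep_comp_incl _ _,
          by rw [adjoint_rightRep, rightRep_comp_incl]⟩)
  refine ⟨θ, hθ, fun a => ?_, fun b => ?_⟩
  · exact eq_of_comp_incl_eq hfaithful (θ _).2 (leftRep_mem_biFreeProduct i a)
      ((hθ _).trans (leftRep_comp_incl _ _).symm)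
  · exact eq_of_comp_incl_eq hfaithful (θ _).2 (rightRep_mem_biFreeProduct i b)
      ((hθ _).trans (rightRep_comp_incl _ _).symm)

/-- The image in the bi-free product of an invertible `c ∈ C_j` with `φ_j(c) = 0` moves the free
vacuum, which is separating by faithfulness, into `H°_j`. -/
theorem exists_reduced_separating (hfaithful : (biFreeState φ F).IsFaithful) {j : I}
    (hj : (faceHilbert φ F j).reduced ≠ ⊥) :
    ∃ k : (faceHilbert φ F j).reduced, ‖k‖ = 1 ∧
      ∀ T ∈ biFreeProduct φ F, T (incl (faceHilbert φ F) j k) = 0 → T = 0 := by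
  obtain ⟨θ, hθ, -⟩ := exists_faceDilation hfaithful j
  obtain ⟨c, hc, h_mem, h_norm⟩ := State.exists_isUnit_norm_toGNS_eq_one hj
  refine ⟨⟨_, h_mem⟩, h_norm, fun T hT h => ?_⟩
  have mul_eq_zero : T * (θ c).1 = 0 := by
    refine eq_zero_of_apply_freeVacuum hfaithful (mul_mem hT (θ c).2) ?_
    rw [← incl_vacuum (i := j)]
    exact (congrArg T congr($(hθ c) (faceHilbert φ F j).vacuum)).trans h
  exact ((hc.map θ).map (biFreeProduct φ F).subtype).mul_left_eq_zero.mp mul_eq_zero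

theorem injective_of_comp_incl_eq {i : I} (hφ : (faceState φ F i).IsFaithful)
    {θ : (F i).generated →⋆ₐ[ℂ] biFreeProduct φ F}
    (hθ : ∀ c, (θ c).1 ∘L (incl (faceHilbert φ F) i).toContinuousLinearMap =
      (incl (faceHilbert φ F) i).toContinuousLinearMap ∘L faceRep φ F i c) :
    Function.Injective θ := fun c d h =>
  hφ.rep_injective <| linearIsometry_comp_injective (incl (faceHilbert φ F) i) <|
    (hθ c).symm.trans (h ▸ hθ d)

/-- With the separating vector in the `j`-th position, the left and right faces of `C_i` act on
separate tensor legs of `H_i ⊗ k ⊗ H_i`, and no element of `C_i` is lost there. -/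
theorem exists_injective_tensorRep (hfaithful : (biFreeState φ F).IsFaithful) {i j : I}
    (hij : i ≠ j) (hφ : (faceState φ F i).IsFaithful) (hj : (faceHilbert φ F j).reduced ≠ ⊥) :
    ∃ σ : (F i).generated →⋆ₐ[ℂ]
        (HilbertTensor (faceHilbert φ F i).carrier (faceHilbert φ F i).carrier →L[ℂ]
          HilbertTensor (faceHilbert φ F i).carrier (faceHilbert φ F i).carrier),
      Function.Injective σ ∧
      (∀ a, σ ((F i).inl a) = hmap (faceRep φ F i ((F i).inl a)) (.id ℂ _)) ∧
      ∀ b, σ ((F i).inr b) = hmap (.id ℂ _) (faceRep φ F i ((F i).inr b)) := by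
  obtain ⟨θ, hθ, θ_inl, θ_inr⟩ := exists_faceDilation hfaithful i
  obtain ⟨k, hk, eq_zero⟩ := exists_reduced_separating hfaithful hj
  obtain ⟨J, J_vacuum, leftRep_comp_J, rightRep_comp_J⟩ :=
    exists_linearIsometry_intertwining (faceHilbert φ F) hij hk
  obtain ⟨σ, hσ⟩ := exists_restriction (θ := (biFreeProduct φ F).subtype.comp θ) (u := J)
    (F i).topologicalClosure_adjoin (by
      rintro _ (⟨a, rfl⟩ | ⟨b, rfl⟩)
      · refine ⟨hmap (faceRep φ F i ((F i).inl a)) (.id ℂ _), ?_⟩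
        rw [StarAlgHom.comp_apply, StarSubalgebra.subtype_apply, θ_inl, adjoint_leftRep,
          adjoint_hmap, ContinuousLinearMap.adjoint_id]
        exact ⟨leftRep_comp_J _, leftRep_comp_J _⟩
      · refine ⟨hmap (.id ℂ _) (faceRep φ F i ((F i).inr b)), ?_⟩
        rw [StarAlgHom.comp_apply, StarSubalgebra.subtype_apply, θ_inr, adjoint_rightRep,
          adjoint_hmap, ContinuousLinearMap.adjoint_id]
        exact ⟨rightRep_comp_J _, rightRep_comp_J _⟩)
  refine ⟨σ, (injective_iff_map_eq_zero σ).mpr fun c hc => ?_, fun a => ?_, fun b => ?_⟩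
  · refine (injective_iff_map_eq_zero θ).mp (injective_of_comp_incl_eq hφ hθ) c
      (Subtype.ext (eq_zero _ (θ c).2 ?_))
    rw [← J_vacuum]
    exact congr($(hσ c) _).trans (by rw [hc, ContinuousLinearMap.comp_zero, zero_apply])
  · exact linearIsometry_comp_injective J ((hσ _).symm.trans
      ((congrArg (· ∘L J.toContinuousLinearMap) (θ_inl a)).trans (leftRep_comp_J _)))
  · exact linearIsometry_comp_injective J ((hσ _).symm.trans
      ((congrArg (· ∘L J.toContinuousLinearMap) (θ_inr b)).trans (rightRep_comp_J _)))

theorem commute_inl_inr (hfaithful : (biFreeState φ F).IsFaithful) {i j : I} (hij : i ≠ j)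
    (hφ : (faceState φ F i).IsFaithful) (hj : (faceHilbert φ F j).reduced ≠ ⊥)
    (a : (F i).left) (b : (F i).right) : Commute ((F i).inl a) ((F i).inr b) := by
  obtain ⟨σ, hσ, σ_inl, σ_inr⟩ := exists_injective_tensorRep hfaithful hij hφ hj
  exact commute_of_map_eq_hmap hσ (π := (faceRep φ F i).comp (F i).inl)
    (ρ := (faceRep φ F i).comp (F i).inr) σ_inl σ_inr a b

theorem faceHilbert_reduced_ne_bot {j : I} (hj : (F j).generated ≠ ⊥)
    (hφ : (faceState φ F j).IsFaithful) :
    (faceHilbert φ F j).reduced ≠ ⊥ := fun h =>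
  hj <| eq_bot_iff.mpr fun x hx => by
    have h_eq : x = faceState φ F j ⟨x, hx⟩ • (1 : A) :=
      congrArg Subtype.val (hφ.eq_smul_one_of_reduced_eq_bot h ⟨x, hx⟩)
    exact h_eq ▸ SMulMemClass.smul_mem _ (one_mem _)

end Faces

end BiFree

end

open BiFree in
theorem mainTheorem1_general {A : Type*} [CStarAlgebra A] (φ : State A) {I : Type*}
    (F : I → PairOfFaces A) (hfaithful : (biFreeState φ F).IsFaithful) {i j : I} (hij : i ≠ j)
    (hφ : (faceState φ F i).IsFaithful) (hj : (faceHilbert φ F j).reduced ≠ ⊥) :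
    (∀ a ∈ (F i).left, ∀ b ∈ (F i).right, a * b = b * a) ∧
      ∃ e : (F i).generated ≃⋆ₐ[ℂ] MinTensor (F i).left (F i).right,
        ∀ (a : (F i).left) (b : (F i).right),
          e ((F i).inl a * (F i).inr b) = MinTensor.tmul a b := by
  have commute := commute_inl_inr hfaithful hij hφ hj
  refine ⟨fun a ha b hb => congrArg Subtype.val (commute ⟨a, ha⟩ ⟨b, hb⟩).eq, ?_⟩
  exact (exists_injective_tensorRep hfaithful hij hφ hj).elim fun σ h =>
    exists_starAlgEquiv_minTensor ((F i).denseRange_mulMap commute) h.1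
      (π := (faceRep φ F i).comp (F i).inl) (hφ.rep_injective.comp (F i).inl_injective)
      (ρ := (faceRep φ F i).comp (F i).inr) (hφ.rep_injective.comp (F i).inr_injective)
      (map_mul_eq_hmap h.2.1 h.2.2)

open BiFree in
theorem mainTheorem1 {A : Type*} [CStarAlgebra A] (φ : BiFree.State A)
    {I : Type*} (F : I → BiFree.PairOfFaces A) (hF : BiFree.IsNontrivialFamily F)
    (hφ : ∀ i, (BiFree.faceState φ F i).IsFaithful)
    (hfaithful : (BiFree.biFreeState φ F).IsFaithful) (i : I) :
    (∀ a ∈ (F i).left, ∀ b ∈ (F i).right, a * b = b * a) ∧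
      ∃ e : (F i).generated ≃⋆ₐ[ℂ] BiFree.MinTensor (F i).left (F i).right,
        ∀ (a : (F i).left) (b : (F i).right),
          e ((F i).inl a * (F i).inr b) = BiFree.MinTensor.tmul a b := by
  have := hF.1
  exact (exists_ne i).elim fun j hj => mainTheorem1_general φ F hfaithful hj.symm (hφ i)
    (faceHilbert_reduced_ne_bot (hF.2 j) (hφ j))
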